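/- Let $\mathbf C$ be an infinitary pretopos, i.e. an exact (regular, with effective equivalence relations) and infinitary extensive category. Let $\Phi$ be an irreducible simply laced root system of rank $\ge 4$ not of type $\mathsf D_4$ (so of type $\mathsf A_\ell$ with $\ell\ge 4$, $\mathsf D_\ell$ with $\ell\ge 5$, or $\mathsf E_6,\mathsf E_7,\mathsf E_8$). Let $R$ be a weakly unital $\Phi$-ring in $\mathbf C$, i.e. a not necessarily unital associative ring object, which is assumed to be commutative unless $\Phi$ is of type $\mathsf A_\ell$, having a weak unit. Here a weak unit is a subobject $\mathcal E\subseteq R$ such that, in the internal (geometric) logic of $\mathbf C$, 1. $\mathcal E\mathcal E\subseteq\mathcal E$ and $\mathcal E$ is central in $R$; 2. for all $\varepsilon,\eta\in\mathcal E$ there exist $\zeta,\varepsilon',\eta'\in\mathcal E$ with $\varepsilon=\varepsilon'\zeta$ and $\eta=\eta'\zeta$; 3. the multiplication morphisms $\mathcal E\times\mathcal E\to\mathcal E$ and $R\times\mathcal E\to R$ are epimorphisms; 4. if $p\varepsilon=0$ with $p\in R$ and $\varepsilon\in\mathcal E$, then there exist $\varepsilon',\varepsilon''\in\mathcal E$ with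 $\varepsilon=\varepsilon'\varepsilon''$ and $p\varepsilon'=0$. Let $\mathrm{St}(\Phi,R)$ be the Steinberg group, i.e. the group object of $\mathbf C$ presented by generators and relations as follows. For $\Phi=\mathsf A_\ell$ the generators are $x_{ij}(p)$ with $p\in R$ and distinct $i,j\in\{1,\dots,\ell+1\}$, and the relations are $$x_{ij}(p)\,x_{ij}(q)=x_{ij}(p+q),\qquad [x_{ij}(p),x_{jk}(q)]=x_{ik}(pq)\ \text{ for } i\ne k,\qquad [x_{ij}(p),x_{kl}(q)]=1\ \text{ for } j\ne k,\ i\ne l.$$ For $R$ commutative (in particular for $\Phi$ of type $\mathsf D_\ell$ or $\mathsf E_\ell$) the generators are $x_\alpha(p)$ with $\alpha\in\Phi$ and $p\in R$, and the relations are $$x_\alpha(p)\,x_\alpha(q)=x_\alpha(p+q),\qquad [x_\alpha(p),x_\beta(q)]=x_{\alpha+\beta}(N_{\alpha\beta}\,pq)\ \text{ for }\alpha+\beta\in\Phi,\qquad [x_\alpha(p),x_\beta(q)]=1\ \text{ for }\alpha+\beta\notin\Phi\cup\{0\},$$ where $N_{\alpha\beta}\in\{\pm1\}$ are the structure constants of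 any Chevalley basis of the complex simple Lie algebra of type $\Phi$. Then the group object $\mathrm{St}(\Phi,R)$ exists and is centrally closed: for every group object $X$ of $\mathbf C$, every epimorphic homomorphism $X\to\mathrm{St}(\Phi,R)$ with central kernel has a section that is a homomorphism. -/

import Mathlib

open CategoryTheory Limits MonoidalCategory CartesianMonoidalCategory

open scoped MonObj AddMonObj commutatorElement

universe w₁ w₂ w₃ v u

/-- An infinitary pretopos: a category that is exact (regular, and every internal equivalence
relation is the kernel pair of its coequalizer) and infinitary extensive (all small coproducts
exist, and they are disjoint and stable under pullback, that is, van Kampen). -/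
class InfinitaryPretopos (C : Type u) [Category.{v} C] : Prop extends Regular C where
  isEffectiveEquivalenceRelation {S X : C} (p₁ p₂ : S ⟶ X) [IsEquivalenceRelation p₁ p₂] :
    IsEffectiveEquivalenceRelation p₁ p₂
  hasCoproducts : HasCoproducts.{v} C
  isVanKampenColimit {J : Type v} {F : Discrete J ⥤ C} (c : Cocone F) (hc : IsColimit c) :
    IsVanKampenColimit c

section Rings

variable {C : Type u} [Category.{v} C] [CartesianMonoidalCategory C]

/-- A not necessarily unital associative ring object. The axioms are written as identities between
generalized elements `T ⟶ R`. -/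
class NonUnitalRingObj (R : C) extends AddGrpObj R where
  /-- The multiplication morphism. -/
  mulHom : R ⊗ R ⟶ R
  add_comm_hom {T : C} (p q : T ⟶ R) : p + q = q + p
  mul_assoc_hom {T : C} (p q r : T ⟶ R) :
    lift (lift p q ≫ mulHom) r ≫ mulHom = lift p (lift q r ≫ mulHom) ≫ mulHom
  mul_add_hom {T : C} (p q r : T ⟶ R) :
    lift p (q + r) ≫ mulHom = lift p q ≫ mulHom + lift p r ≫ mulHom
  add_mul_hom {T : C} (p q r : T ⟶ R) :
    lift (p + q) r ≫ mulHom = lift p r ≫ mulHom + lift q r ≫ mulHom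

/-- The generalized elements of a ring object at every stage form a ring. -/
instance NonUnitalRingObj.homRing {R : C} [NonUnitalRingObj R] {T : C} :
    NonUnitalRing (T ⟶ R) where
  __ := (Hom.addGroup : AddGroup (T ⟶ R))
  add_comm := NonUnitalRingObj.add_comm_hom
  mul p q := lift p q ≫ NonUnitalRingObj.mulHom
  left_distrib := NonUnitalRingObj.mul_add_hom
  right_distrib := NonUnitalRingObj.add_mul_hom
  mul_assoc := NonUnitalRingObj.mul_assoc_hom
  zero_mul p := by
    have h := NonUnitalRingObj.add_mul_hom (0 : T ⟶ R) 0 p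
    rw [add_zero] at h
    exact left_eq_add.mp h
  mul_zero p := by
    have h := NonUnitalRingObj.mul_add_hom p (0 : T ⟶ R) 0
    rw [add_zero] at h
    exact left_eq_add.mp h

/-- The subobject `E` of the ring object `R` is a weak unit. `E.Factors a` says that the
generalized element `a` of `R` lies in `E`. An existential quantifier of the internal (geometric)
logic means existence after passing to a cover, that is, along an epimorphism `T' ⟶ T`. -/
structure IsWeakUnit {R : C} [NonUnitalRingObj R] (E : Subobject R) : Prop where
  mul_mem {T : C} (a b : T ⟶ R) (ha : E.Factors a) (hb : E.Factors b) : E.Factors (a * b)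
  central {T : C} (a p : T ⟶ R) (ha : E.Factors a) : a * p = p * a
  exists_common_divisor {T : C} (a b : T ⟶ R) (ha : E.Factors a) (hb : E.Factors b) :
    ∃ (T' : C) (f : T' ⟶ T) (_ : Epi f) (z a' b' : T' ⟶ R),
      E.Factors z ∧ E.Factors a' ∧ E.Factors b' ∧ f ≫ a = a' * z ∧ f ≫ b = b' * z
  /-- The multiplication morphism `E × E ⟶ E` is an epimorphism. -/
  epi_mul_self (m : (E : C) ⊗ (E : C) ⟶ (E : C))
    (hm : m ≫ E.arrow = (fst (E : C) (E : C) ≫ E.arrow) * (snd (E : C) (E : C) ≫ E.arrow)) :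
    Epi m
  /-- The multiplication morphism `R × E ⟶ R` is an epimorphism. -/
  epi_mul : Epi (fst R (E : C) * (snd R (E : C) ≫ E.arrow))
  exists_factor_of_mul_eq_zero {T : C} (p a : T ⟶ R) (ha : E.Factors a) (h : p * a = 0) :
    ∃ (T' : C) (f : T' ⟶ T) (_ : Epi f) (a' a'' : T' ⟶ R),
      E.Factors a' ∧ E.Factors a'' ∧ f ≫ a = a' * a'' ∧ (f ≫ p) * a' = 0

/-- A ring object is weakly unital if it has a weak unit. -/
def WeaklyUnital (R : C) [NonUnitalRingObj R] : Prop :=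
  ∃ E : Subobject R, IsWeakUnit E

end Rings

section CentralExtensions

variable {C : Type u} [Category.{v} C] [CartesianMonoidalCategory C]

/-- A central extension of group objects: an epimorphic homomorphism with central kernel. -/
structure IsCentralExtension {X G : C} [GrpObj X] [GrpObj G] (f : X ⟶ G) : Prop where
  isMonHom : IsMonHom f
  epi : Epi f
  central {T : C} (k g : T ⟶ X) (hk : k ≫ f = 1) : k * g = g * k

/-- A group object is centrally closed if all its central extensions split. -/
def CentrallyClosed (G : C) [GrpObj G] : Prop :=
  ∀ (X : C) [GrpObj X] (f : X ⟶ G), IsCentralExtension f →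
    ∃ s : G ⟶ X, IsMonHom s ∧ s ≫ f = 𝟙 G

end CentralExtensions

section LinearSteinberg

variable {C : Type u} [Category.{v} C] [CartesianMonoidalCategory C]

/-- The Steinberg relations of type `A` of rank `n - 1` (indices from `1` to `n`) between morphisms
`x i j : R ⟶ G`. The commutator is `⁅g, h⁆ = g * h * g⁻¹ * h⁻¹`. -/
structure LinearSteinbergRelations {n : ℕ} {R G : C} [NonUnitalRingObj R] [GrpObj G]
    (x : ∀ i j : Fin n, i ≠ j → (R ⟶ G)) : Prop where
  add (i j : Fin n) (hij : i ≠ j) {T : C} (p q : T ⟶ R) :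
    (p ≫ x i j hij) * (q ≫ x i j hij) = (p + q) ≫ x i j hij
  commutator (i j k : Fin n) (hij : i ≠ j) (hjk : j ≠ k) (hik : i ≠ k) {T : C} (p q : T ⟶ R) :
    ⁅p ≫ x i j hij, q ≫ x j k hjk⁆ = (p * q) ≫ x i k hik
  commute (i j k l : Fin n) (hij : i ≠ j) (hkl : k ≠ l) (hjk : j ≠ k) (hil : i ≠ l)
    {T : C} (p q : T ⟶ R) : ⁅p ≫ x i j hij, q ≫ x k l hkl⁆ = 1

/-- The group object `G` with the root morphisms `x i j` is the Steinberg group of type `A` of rank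
`n - 1` over `R`: it is presented by the generators `x i j` and the Steinberg relations. -/
structure IsLinearSteinbergGroup {n : ℕ} {R G : C} [NonUnitalRingObj R] [GrpObj G]
    (x : ∀ i j : Fin n, i ≠ j → (R ⟶ G)) : Prop where
  relations : LinearSteinbergRelations x
  universal (H : C) [GrpObj H] (y : ∀ i j : Fin n, i ≠ j → (R ⟶ H))
    (hy : LinearSteinbergRelations y) :
    ∃! f : G ⟶ H, IsMonHom f ∧ ∀ (i j : Fin n) (hij : i ≠ j), x i j hij ≫ f = y i j hij

end LinearSteinberg

section RootSystems

variable {I : Type w₁} {M : Type w₂} {N : Type w₃} [AddCommGroup M] [Module ℝ M]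
  [AddCommGroup N] [Module ℝ N]

/-- A root system is simply laced if non-proportional roots `α`, `β` have
`2 (α, β) / (β, β)` equal to `0`, `1` or `-1`. -/
def RootIsSimplyLaced (P : RootPairing I ℝ M N) : Prop :=
  ∀ i j : I, P.root i ≠ P.root j → P.root i ≠ -P.root j →
    P.pairing i j = 0 ∨ P.pairing i j = 1 ∨ P.pairing i j = -1

/-- The root system has type `D₄`: with respect to some base its Cartan matrix is that of `D₄`. -/
def RootIsTypeD4 [Finite I] (P : RootPairing I ℝ M N) [P.IsCrystallographic] : Prop :=
  ∃ (b : P.Base) (e : b.support ≃ Fin 4), b.cartanMatrix = (CartanMatrix.D 4).submatrix e e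

/-- The elements `e i` (root vectors) and `h i` (coroots) form a Chevalley basis of the complex Lie
algebra `L` with the simply laced root system `P`, and `c` is its family of structure constants
(the values `c i j` matter only if the sum of the `i`-th and the `j`-th root is a root). -/
structure IsChevalleySystem (P : RootPairing I ℝ M N) [P.IsCrystallographic]
    {L : Type} [LieRing L] [LieAlgebra ℂ L] (e h : I → L) (c : I → I → ℤˣ) : Prop where
  linearIndependent : LinearIndependent ℂ e
  span_eq_top : Submodule.span ℂ (Set.range e ∪ Set.range h) = ⊤
  lie_h_h (i j : I) : ⁅h i, h j⁆ = 0
  lie_h_e (i j : I) : ⁅h i, e j⁆ = P.pairingIn ℤ j i • e j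
  lie_e_neg (i j : I) (hij : P.root j = -P.root i) : ⁅e i, e j⁆ = h i
  lie_e_e (i j k : I) (hk : P.root k = P.root i + P.root j) : ⁅e i, e j⁆ = (c i j : ℤ) • e k
  lie_e_e_eq_zero (i j : I) (h₀ : P.root i + P.root j ≠ 0)
    (hij : P.root i + P.root j ∉ Set.range P.root) : ⁅e i, e j⁆ = 0

/-- `c` is a family of structure constants of the simply laced root system `P`, i.e. that of some
Chevalley basis. -/
def IsStructureConstants (P : RootPairing I ℝ M N) [P.IsCrystallographic]
    (c : I → I → ℤˣ) : Prop :=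
  ∃ (L : Type) (_ : LieRing L) (_ : LieAlgebra ℂ L) (e h : I → L), IsChevalleySystem P e h c

variable {C : Type u} [Category.{v} C] [CartesianMonoidalCategory C]

/-- The Steinberg relations of the simply laced root system `P` with the structure constants `c`
between morphisms `x i : R ⟶ G`. The commutator is `⁅g, h⁆ = g * h * g⁻¹ * h⁻¹`. -/
structure SteinbergRelations (P : RootPairing I ℝ M N) (c : I → I → ℤˣ) {R G : C}
    [NonUnitalRingObj R] [GrpObj G] (x : I → (R ⟶ G)) : Prop where
  add (i : I) {T : C} (p q : T ⟶ R) : (p ≫ x i) * (q ≫ x i) = (p + q) ≫ x i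
  commutator (i j k : I) (hk : P.root k = P.root i + P.root j) {T : C} (p q : T ⟶ R) :
    ⁅p ≫ x i, q ≫ x j⁆ = ((c i j : ℤ) • (p * q)) ≫ x k
  commute (i j : I) (h₀ : P.root i + P.root j ≠ 0)
    (hij : P.root i + P.root j ∉ Set.range P.root) {T : C} (p q : T ⟶ R) :
    ⁅p ≫ x i, q ≫ x j⁆ = 1

/-- The group object `G` with the root morphisms `x i` is the Steinberg group of the simply laced
root system `P` over `R`: it is presented by the generators `x i` and the Steinberg relations. -/
structure IsSteinbergGroup (P : RootPairing I ℝ M N) (c : I → I → ℤˣ) {R G : C}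
    [NonUnitalRingObj R] [GrpObj G] (x : I → (R ⟶ G)) : Prop where
  relations : SteinbergRelations P c x
  universal (H : C) [GrpObj H] (y : I → (R ⟶ H)) (hy : SteinbergRelations P c y) :
    ∃! f : G ⟶ H, IsMonHom f ∧ ∀ i : I, x i ≫ f = y i

end RootSystems

/-!
The group `St(Φ, R)` is the sheaf quotient of the free monoid on the generators by the congruence
of the relations. Internally, existence and disjunction mean truth on a covering sieve of the
canonical topology.

Let `f : X ⟶ St(Φ, R)` be a central extension. The commutator `[u, v]` of lifts does not depend on
the choice of the lifts, so it defines a bracket on `St(Φ, R)` with values in `X`. If a root `t` is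
a sum `i + j`, then the lift of `x_t(p q)` should be the bracket of `x_i(p)` and `x_j(q)`; one has
to show that the bracket depends only on the product `p q`, that it does not depend on the
decomposition of `t`, and that the morphisms `R ⟶ X` obtained this way satisfy the Steinberg
relations.

* Lifts of `x_i(p)` and `x_j(q)` commute if `i` is a sum of two roots whose sums with `j` are
  neither zero nor a root, since `b` commutes with `[u, v]` whenever `[b, u]` and `[b, v]` are
  central.
* For roots `a`, `b`, `c` such that `a + c` is neither zero nor a root, the Hall–Witt identity shows
  that, up to signs, `[x_a(p), x_{b+c}(q r)] = [x_{a+b}(p q), x_c(r)]` holds in `X` if and only if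
  the lifts of `x_{a+b}(p q)` and `x_{b+c}(q r)` commute. If they do, the identity changes
  decompositions of roots and moves factors between the arguments; by the weak unit, a biadditive
  function that is balanced in this sense factors through the multiplication of `R`.

In type `A` of rank at least `4` the first argument shows that all the lifts in question commute.
In the simply laced case it can fail only for orthogonal roots `i`, `j` that are joined to the same
roots. Three mutually orthogonal roots that are joined to a common root and all to the same roots
generate, with that root, a subsystem of type `D₄` that is orthogonal to all other roots, hence all
of `Φ`. If `Φ` is not of type `D₄`, one can therefore pass between any two decompositions of `t`
while avoiding exceptional pairs. Once the lifts of the root morphisms are known, the equivalence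
of the second argument, read backwards, shows that lifts for the exceptional pairs commute as well.
-/

universe w

section Locality

variable {C : Type u} [Category.{v} C]

/-- A property of the morphisms into `T` holds locally if it holds on a sieve that covers `T` in
the canonical topology. This is existence and disjunction in the internal logic. -/
def Locally (T : C) (P : ∀ ⦃T' : C⦄, (T' ⟶ T) → Prop) : Prop :=
  ∃ S ∈ Sheaf.canonicalTopology C T, ∀ ⦃T' : C⦄ (f : T' ⟶ T), S f → P f

namespace Locally

variable {T : C} {P Q : ∀ ⦃T' : C⦄, (T' ⟶ T) → Prop}

theorem of_forall (h : ∀ ⦃T' : C⦄ (f : T' ⟶ T), P f) : Locally T P :=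
  ⟨⊤, (Sheaf.canonicalTopology C).top_mem T, fun _ f _ => h f⟩

theorem mono (hP : Locally T P) (h : ∀ ⦃T' : C⦄ (f : T' ⟶ T), P f → Q f) : Locally T Q := by
  obtain ⟨S, hS, hSP⟩ := hP
  exact ⟨S, hS, fun T' f hf => h f (hSP f hf)⟩

theorem and (hP : Locally T P) (hQ : Locally T Q) : Locally T (fun _ f => P f ∧ Q f) := by
  obtain ⟨S, hS, hSP⟩ := hP
  obtain ⟨S', hS', hSQ⟩ := hQ
  exact ⟨S ⊓ S', (Sheaf.canonicalTopology C).intersection_covering hS hS',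
    fun T' f hf => ⟨hSP f hf.1, hSQ f hf.2⟩⟩

theorem pullback (hP : Locally T P) {T₁ : C} (g : T₁ ⟶ T) : Locally T₁ (fun _ f => P (f ≫ g)) := by
  obtain ⟨S, hS, hSP⟩ := hP
  exact ⟨S.pullback g, (Sheaf.canonicalTopology C).pullback_stable g hS,
    fun T' f hf => hSP (f ≫ g) hf⟩

theorem bind (hP : Locally T P)
    (h : ∀ ⦃T' : C⦄ (f : T' ⟶ T), P f → Locally T' (fun _ g => Q (g ≫ f))) : Locally T Q := by
  obtain ⟨S, hS, hSP⟩ := hP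
  choose V hV hVQ using fun (T' : C) (f : T' ⟶ T) (hf : S f) => h f (hSP f hf)
  refine ⟨Sieve.bind S.arrows fun T' f hf => V T' f hf,
    (Sheaf.canonicalTopology C).bind_covering hS fun T' f hf => hV T' f hf, ?_⟩
  rintro T' _ ⟨Y, g, f, hf, hg, rfl⟩
  exact hVQ _ f hf g hg

theorem eq {X : C} {a b : T ⟶ X} (h : Locally T (fun _ f => f ≫ a = f ≫ b)) : a = b := by
  obtain ⟨S, hS, hSP⟩ := h
  exact ((Sheaf.isSheaf_yoneda_obj X) S hS).isSeparatedFor.ext fun T' f hf => hSP f hf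

/-- `F` is a family of local parameters for the generalized elements of `Q`. The morphism out of `Q`
exists because representable presheaves are sheaves. -/
theorem exists_desc {F : C → Type w} {Q X : C} (θ : ∀ {T : C}, F T → (T ⟶ Q))
    (φ : ∀ {T : C}, F T → (T ⟶ X))
    (hres : ∀ {T T' : C} (g : T' ⟶ T) (l : F T), ∃ l' : F T', g ≫ θ l = θ l' ∧ g ≫ φ l = φ l')
    (hφ : ∀ {T : C} (l l' : F T), θ l = θ l' → φ l = φ l')
    (hex : Locally Q fun T f => ∃ l : F T, θ l = f) :
    ∃ h : Q ⟶ X, ∀ {T : C} (l : F T), θ l ≫ h = φ l := by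
  obtain ⟨S, hS, hSF⟩ := id hex
  choose l hl using hSF
  have hcomp : Presieve.FamilyOfElements.Compatible (P := yoneda.obj X) (R := S.arrows)
      fun T f hf => φ (l f hf) := by
    intro Y₁ Y₂ Z g₁ g₂ f₁ f₂ h₁ h₂ e
    obtain ⟨l₁, hθ₁, hφ₁⟩ := hres g₁ (l f₁ h₁)
    obtain ⟨l₂, hθ₂, hφ₂⟩ := hres g₂ (l f₂ h₂)
    change g₁ ≫ φ (l f₁ h₁) = g₂ ≫ φ (l f₂ h₂)
    rw [hφ₁, hφ₂, hφ l₁ l₂ (by rw [← hθ₁, ← hθ₂, hl, hl, e])]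
  obtain ⟨h, hh, -⟩ := (Sheaf.isSheaf_yoneda_obj X) S hS _ hcomp
  have hS' : Locally Q fun T f => ∃ l : F T, θ l = f ∧ f ≫ h = φ l :=
    ⟨S, hS, fun T f hf => ⟨l f hf, hl f hf, hh f hf⟩⟩
  refine ⟨h, fun l₀ => eq ((hS'.pullback (θ l₀)).mono ?_)⟩
  rintro T f ⟨l₁, hθ₁, hφ₁⟩
  obtain ⟨l₂, hθ₂, hφ₂⟩ := hres f l₀
  rw [← Category.assoc, hφ₁, hφ₂, hφ l₁ l₂ (hθ₁.trans hθ₂)]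

theorem lift_mono {A X : C} (m : A ⟶ X) [Mono m] {a : T ⟶ X}
    (h : Locally T (fun _ f => ∃ b, b ≫ m = f ≫ a)) : ∃ b, b ≫ m = a := by
  obtain ⟨b, hb⟩ := exists_desc (F := fun T' => {p : (T' ⟶ T) × (T' ⟶ A) // p.2 ≫ m = p.1 ≫ a})
    (fun p => p.1.1) (fun p => p.1.2)
    (fun g p => ⟨⟨(g ≫ p.1.1, g ≫ p.1.2), by simp [p.2]⟩, rfl, rfl⟩)
    (fun p p' e => by rw [← cancel_mono m, p.2, p'.2, e])
    (h.mono fun T' f ⟨b, hb⟩ => ⟨⟨(f, b), hb⟩, rfl⟩)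
  refine ⟨b, eq (h.mono fun T' f ⟨c, hc⟩ => ?_)⟩
  have hfb : f ≫ b = c := hb ⟨(f, c), hc⟩
  rw [reassoc_of% hfb, hc]

end Locally

theorem isSheafFor_yoneda_of_isColimit {J : Type w} {X : J → C} {c : Cofan X} (hc : IsColimit c)
    (Z : C) : (Presieve.ofArrows X c.inj).IsSheafFor (yoneda.obj Z) := by
  intro x _
  refine ⟨Cofan.IsColimit.desc hc fun j => x (c.inj j) (.mk j), ?_, ?_⟩
  · rintro Y f ⟨j⟩
    exact Cofan.IsColimit.fac hc _ j
  · intro y hy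
    refine Cofan.IsColimit.hom_ext hc _ _ fun j => ?_
    rw [Cofan.IsColimit.fac hc]
    exact hy _ (.mk j)

end Locality

section Covers

variable {C : Type u} [Category.{v} C]

theorem Locally.of_isRegularEpi [Regular C] {T T₀ : C} (p : T₀ ⟶ T) [IsRegularEpi p] :
    Locally T (fun _ f => ∃ g, g ≫ p = f) := by
  refine ⟨Sieve.generate (Presieve.singleton p), ?_, ?_⟩
  · refine Sheaf.mem_finestTopology_of_forall_isSheafFor ?_
    rintro _ ⟨X, rfl⟩ Y f
    have : (Presieve.singleton p).HasPullbacks f := ⟨fun _ => inferInstance⟩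
    have : EffectiveEpi (Limits.pullback.snd p f) :=
      (isRegularEpi_iff_effectiveEpi _).mp inferInstance
    rw [← Sieve.pullbackArrows_comm, Presieve.pullback_singleton,
      ← Presieve.isSheafFor_iff_generate]
    exact Presieve.IsSheafFor.singleton_of_isRepresentable_of_effectiveEpi _ _
  · rintro T' f ⟨Y, g, h, ⟨⟩, rfl⟩
    exact ⟨g, rfl⟩

variable [InfinitaryPretopos C]

instance InfinitaryPretopos.hasCoproduct {J : Type v} (X : J → C) : HasCoproduct X :=
  InfinitaryPretopos.hasCoproducts J |>.has_colimit _

theorem InfinitaryPretopos.isVanKampenColimit_sigma {J : Type v} (X : J → C) :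
    IsVanKampenColimit (Cofan.mk (∐ X) (Sigma.ι X)) :=
  InfinitaryPretopos.isVanKampenColimit _ (coproductIsCoproduct X)

theorem InfinitaryPretopos.nonempty_isColimit_pullback_sigma {J : Type v} (X : J → C) {Y : C}
    (f : Y ⟶ ∐ X) :
    Nonempty (IsColimit (Cofan.mk Y fun j => Limits.pullback.snd (Sigma.ι X j) f)) :=
  (isVanKampenColimit_sigma X).isUniversal.nonempty_isColimit_of_isPullback_right
    (fun j => Sigma.ι X j) (𝟙 _) f (fun j => Limits.pullback.fst (Sigma.ι X j) f)
    (fun j => Limits.pullback.snd (Sigma.ι X j) f) (fun j => IsPullback.of_hasPullback _ _)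
    (IsPullback.id_horiz f).flip _ (Iso.refl _) (fun j => by simp)
    (fun j => by simp [Cofan.inj, pullback.condition]) (fun j => by simp)

theorem Locally.of_sigma {J : Type v} (X : J → C) {T : C} (a : T ⟶ ∐ X) :
    Locally T (fun _ f => ∃ (j : J) (b : _ ⟶ X j), b ≫ Sigma.ι X j = f ≫ a) := by
  refine Locally.pullback (P := fun _ f => ∃ (j : J) (b : _ ⟶ X j), b ≫ Sigma.ι X j = f) ?_ a
  refine ⟨Sieve.generate (Presieve.ofArrows X (Sigma.ι X)), ?_, ?_⟩
  · refine Sheaf.mem_finestTopology_of_forall_isSheafFor ?_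
    rintro _ ⟨Z, rfl⟩ Y f
    have : (Presieve.ofArrows X (Sigma.ι X)).HasPullbacks f := ⟨fun _ => inferInstance⟩
    obtain ⟨hY⟩ := InfinitaryPretopos.nonempty_isColimit_pullback_sigma X f
    rw [← Sieve.pullbackArrows_comm, ← Presieve.ofArrows_pullback,
      ← Presieve.isSheafFor_iff_generate]
    exact isSheafFor_yoneda_of_isColimit hY Z
  · rintro T' f ⟨Y, g, h, ⟨j⟩, rfl⟩
    exact ⟨j, g, rfl⟩

instance InfinitaryPretopos.hasInitial : HasInitial C := by
  have := InfinitaryPretopos.hasCoproducts (C := C) PEmpty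
  exact hasColimitsOfShape_of_equivalence
    (Discrete.equivalence (Equiv.equivOfIsEmpty PEmpty.{v + 1} PEmpty.{1}))

/-- By disjointness, `T` maps to the initial object, which has an empty cover. -/
theorem Locally.of_sigma_ne {J : Type v} (X : J → C) {T : C} {i j : J} (hij : i ≠ j)
    (a : T ⟶ X i) (b : T ⟶ X j) (h : a ≫ Sigma.ι X i = b ≫ Sigma.ι X j)
    (P : ∀ ⦃T' : C⦄, (T' ⟶ T) → Prop) : Locally T P := by
  have hp := isPullback_initial_to_of_cofan_isVanKampen
    (InfinitaryPretopos.isVanKampenColimit_sigma X) ⟨i⟩ ⟨j⟩ (by simpa using hij)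
  exact (Locally.of_sigma (PEmpty.elim : PEmpty.{v + 1} → C)
    (hp.lift a b h ≫ initial.to _)).mono fun T' f ⟨j, _⟩ => j.elim

theorem InfinitaryPretopos.mono_sigma_ι {J : Type v} (X : J → C) (j : J) : Mono (Sigma.ι X j) :=
  mono_of_cofan_isVanKampen (isVanKampenColimit_sigma X) ⟨j⟩

end Covers

section Quotients

variable {C : Type u} [Category.{v} C]

/-- Two generalized elements are related by a span if locally they are the images of a generalized
element of the span. -/
def SpanRel {S D : C} (p₁ p₂ : S ⟶ D) {T : C} (a b : T ⟶ D) : Prop :=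
  Locally T fun _ f => ∃ s, s ≫ p₁ = f ≫ a ∧ s ≫ p₂ = f ≫ b

theorem spanRel_sigma_desc [InfinitaryPretopos C] {J : Type v} {X : J → C} {D : C}
    (p₁ p₂ : ∀ j, X j ⟶ D) {T : C} (a b : T ⟶ D) :
    SpanRel (Sigma.desc p₁) (Sigma.desc p₂) a b ↔
      Locally T fun _ f => ∃ (j : J) (s : _ ⟶ X j), s ≫ p₁ j = f ≫ a ∧ s ≫ p₂ j = f ≫ b := by
  refine ⟨fun h => h.bind ?_, fun h => h.mono ?_⟩
  · rintro T' f ⟨s, hs₁, hs₂⟩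
    refine (Locally.of_sigma X s).mono ?_
    rintro T'' g ⟨j, t, ht⟩
    refine ⟨j, t, ?_, ?_⟩
    · rw [Category.assoc, ← hs₁, ← reassoc_of% ht, Sigma.ι_desc]
    · rw [Category.assoc, ← hs₂, ← reassoc_of% ht, Sigma.ι_desc]
  · rintro T' f ⟨j, s, hs₁, hs₂⟩
    exact ⟨s ≫ Sigma.ι X j, by simpa using hs₁, by simpa using hs₂⟩

theorem exists_lift_iff_spanRel [CartesianMonoidalCategory C] [Regular C] {S A D : C} (e : S ⟶ A)
    [IsRegularEpi e] (m : A ⟶ D ⊗ D) [Mono m] {T : C} (a b : T ⟶ D) :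
    (∃ t, t ≫ m ≫ fst D D = a ∧ t ≫ m ≫ snd D D = b) ↔
      SpanRel ((e ≫ m) ≫ fst D D) ((e ≫ m) ≫ snd D D) a b := by
  constructor
  · rintro ⟨t, rfl, rfl⟩
    refine ((Locally.of_isRegularEpi e).pullback t).mono ?_
    rintro T' f ⟨g, hg⟩
    exact ⟨g, by simp [reassoc_of% hg], by simp [reassoc_of% hg]⟩
  · intro h
    obtain ⟨t, ht⟩ := Locally.lift_mono m (a := lift a b) (h.mono (by
      rintro T' f ⟨s, h₁, h₂⟩
      exact ⟨s ≫ e, CartesianMonoidalCategory.hom_ext _ _ (by simpa using h₁)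
        (by simpa using h₂)⟩))
    exact ⟨t, by rw [reassoc_of% ht, lift_fst], by rw [reassoc_of% ht, lift_snd]⟩

theorem isEquivalenceRelation_of_setoid [HasPullbacks C] {A D : C} (d₁ d₂ : A ⟶ D)
    (hmono : ∀ {T : C} (f g : T ⟶ A), f ≫ d₁ = g ≫ d₁ → f ≫ d₂ = g ≫ d₂ → f = g)
    (r : ∀ T : C, Setoid (T ⟶ D))
    (hr : ∀ {T : C} (a b : T ⟶ D), r T a b ↔ ∃ t, t ≫ d₁ = a ∧ t ≫ d₂ = b) :
    IsEquivalenceRelation d₁ d₂ := by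
  have hgen : ∀ {T : C} (t : T ⟶ A), r T (t ≫ d₁) (t ≫ d₂) :=
    fun t => (hr _ _).mpr ⟨t, rfl, rfl⟩
  obtain ⟨ρ, hρ₁, hρ₂⟩ := (hr _ _).mp ((r D).refl (𝟙 D))
  obtain ⟨s, hs₁, hs₂⟩ := (hr _ _).mp ((r A).symm (hgen (𝟙 A)))
  have hsnd := hgen (pullback.snd d₂ d₁)
  rw [← pullback.condition] at hsnd
  obtain ⟨τ, hτ₁, hτ₂⟩ := (hr _ _).mp ((r _).trans (hgen (pullback.fst d₂ d₁)) hsnd)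
  exact ⟨⟨{
    right_cancellation _ f g := hmono f g
    r := ρ
    reflexivity₁ := hρ₁
    reflexivity₂ := hρ₂
    s := s
    symmetry₁ := by simpa using hs₁
    symmetry₂ := by simpa using hs₂
    c := PullbackCone.mk _ _ pullback.condition
    isLimit := pullbackIsPullback d₂ d₁
    t := τ
    transitivity₁ := hτ₁
    transitivity₂ := hτ₂ }⟩⟩

theorem exists_quotient_of_setoid [CartesianMonoidalCategory C] [InfinitaryPretopos C] {S D : C}
    (p₁ p₂ : S ⟶ D) (r : ∀ T : C, Setoid (T ⟶ D))
    (hr : ∀ {T : C} (a b : T ⟶ D), r T a b ↔ SpanRel p₁ p₂ a b) :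
    ∃ (Q : C) (q : D ⟶ Q), IsRegularEpi q ∧ ∀ {T : C} (a b : T ⟶ D), a ≫ q = b ≫ q ↔ r T a b := by
  let F := Regular.strongEpiMonoFactorisation (lift p₁ p₂)
  have hF : F.e ≫ F.m = lift p₁ p₂ := F.fac
  have hlift : ∀ {T : C} (a b : T ⟶ D),
      r T a b ↔ ∃ t, t ≫ F.m ≫ fst D D = a ∧ t ≫ F.m ≫ snd D D = b := fun a b => by
    rw [hr, exists_lift_iff_spanRel F.e F.m, hF, lift_fst, lift_snd]
  have := isEquivalenceRelation_of_setoid (F.m ≫ fst D D) (F.m ≫ snd D D)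
    (fun f g h₁ h₂ => by
      rw [← cancel_mono F.m]
      exact CartesianMonoidalCategory.hom_ext _ _ (by simpa using h₁) (by simpa using h₂)) r hlift
  obtain ⟨⟨e⟩⟩ := InfinitaryPretopos.isEffectiveEquivalenceRelation (F.m ≫ fst D D) (F.m ≫ snd D D)
  refine ⟨e.B, e.π, inferInstance, fun a b => ⟨fun h => (hlift a b).mpr ?_, fun h => ?_⟩⟩
  · exact ⟨e.isKernelPair.lift a b h, e.isKernelPair.lift_fst a b h, e.isKernelPair.lift_snd a b h⟩
  · obtain ⟨t, rfl, rfl⟩ := (hlift a b).mp h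
    simpa only [Category.assoc] using congr(t ≫ $(e.isKernelPair.w))

end Quotients

section Balanced

variable {C : Type u} [Category.{v} C]

/-- The relation between generalized elements of `D` that identifies, in each fibre of `q : D ⟶ B`
over the image of `m : A ⟶ B`, all elements. For two copies `D` of `B` with the fold map `q`, the
quotient is the cokernel pair of `m`. -/
def FibreRel {A B D : C} (m : A ⟶ B) (q : D ⟶ B) (T : C) : Setoid (T ⟶ D) where
  r a b := a ≫ q = b ≫ q ∧ Locally T fun _ f => f ≫ a = f ≫ b ∨ ∃ x, x ≫ m = f ≫ a ≫ q
  iseqv :=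
    { refl := fun _ => ⟨rfl, .of_forall fun _ _ => .inl rfl⟩
      symm := fun ⟨hq, h⟩ => ⟨hq.symm, h.mono fun _ _ => Or.imp Eq.symm fun hx => hq ▸ hx⟩
      trans := fun ⟨hq, h⟩ ⟨hq', h'⟩ => ⟨hq.trans hq', (h.and h').mono fun _ _ => by
        rintro ⟨h | h, h' | h'⟩
        · exact .inl (h.trans h')
        · exact .inr (hq ▸ h')
        · exact .inr h
        · exact .inr h⟩ }

variable [InfinitaryPretopos C]

theorem exists_span_fibreRel {A B D : C} (m : A ⟶ B) (q : D ⟶ B) :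
    ∃ (S : C) (p₁ p₂ : S ⟶ D),
      ∀ {T : C} (a b : T ⟶ D), FibreRel m q T a b ↔ SpanRel p₁ p₂ a b := by
  let π := pullback.fst (pullback.fst q q ≫ q) m
  let X : ULift.{v} Bool → C := fun i => bif i.down then pullback (pullback.fst q q ≫ q) m else D
  let p₁ : ∀ i, X i ⟶ D := fun | ⟨true⟩ => π ≫ pullback.fst q q | ⟨false⟩ => 𝟙 D
  let p₂ : ∀ i, X i ⟶ D := fun | ⟨true⟩ => π ≫ pullback.snd q q | ⟨false⟩ => 𝟙 D
  refine ⟨∐ X, Sigma.desc p₁, Sigma.desc p₂, fun {T} a b => ?_⟩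
  rw [spanRel_sigma_desc]
  constructor
  · rintro ⟨hq, h⟩
    refine h.mono ?_
    rintro T' f (hab | ⟨x, hx⟩)
    · exact ⟨⟨false⟩, f ≫ a, Category.comp_id _, by rw [hab]; exact Category.comp_id _⟩
    · have hab : (f ≫ a) ≫ q = (f ≫ b) ≫ q := by rw [Category.assoc, hq, Category.assoc]
      refine ⟨⟨true⟩, pullback.lift (pullback.lift (f ≫ a) (f ≫ b) hab) x ?_, ?_, ?_⟩
      · rw [pullback.lift_fst_assoc, Category.assoc, hx]
      · rw [pullback.lift_fst_assoc, pullback.lift_fst]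
      · rw [pullback.lift_fst_assoc, pullback.lift_snd]
  · intro h
    have hcase := h.mono (Q := fun _ f => (f ≫ a) ≫ q = (f ≫ b) ≫ q ∧
        (f ≫ a = f ≫ b ∨ ∃ x, x ≫ m = f ≫ a ≫ q)) <| by
      rintro T' f ⟨⟨_ | _⟩, s, hs₁, hs₂⟩
      · have hab := hs₁.symm.trans hs₂
        exact ⟨congr($hab ≫ q), .inl hab⟩
      · change s ≫ π ≫ _ = _ at hs₁
        change s ≫ π ≫ _ = _ at hs₂
        refine ⟨?_, .inr ⟨s ≫ pullback.snd _ _, ?_⟩⟩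
        · rw [← hs₁, ← hs₂, Category.assoc, Category.assoc, Category.assoc, Category.assoc,
            pullback.condition (f := q)]
        · rw [← Category.assoc, ← hs₁, Category.assoc, Category.assoc, Category.assoc,
            ← pullback.condition]
    exact ⟨Locally.eq (hcase.mono fun _ _ h => by simpa only [Category.assoc] using h.1),
      hcase.mono fun _ _ h => h.2⟩

variable [CartesianMonoidalCategory C]

instance InfinitaryPretopos.isRegularMonoCategory : IsRegularMonoCategory C where
  regularMonoOfMono {A B} m _ := by
    let X : ULift.{v} Bool → C := fun _ => B
    let fold : ∐ X ⟶ B := Sigma.desc fun _ => 𝟙 B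
    have hι : ∀ i {T : C} (b : T ⟶ B), b ≫ (Sigma.ι X i) ≫ fold = b := by simp [fold, X]
    obtain ⟨S, p₁, p₂, hS⟩ := exists_span_fibreRel m fold
    obtain ⟨Q, q, -, hq⟩ := exists_quotient_of_setoid p₁ p₂ _ hS
    have hm : m ≫ Sigma.ι X ⟨false⟩ ≫ q = m ≫ Sigma.ι X ⟨true⟩ ≫ q := by
      rw [← Category.assoc, ← Category.assoc, hq]
      exact ⟨by rw [Category.assoc, hι, Category.assoc, hι],
        .of_forall fun T f => .inr ⟨f, by rw [Category.assoc, hι]⟩⟩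
    have hlift : ∀ {T : C} (b : T ⟶ B), b ≫ Sigma.ι X ⟨false⟩ ≫ q = b ≫ Sigma.ι X ⟨true⟩ ≫ q →
        ∃ a, a ≫ m = b := fun b hb => by
      rw [← Category.assoc, ← Category.assoc, hq] at hb
      refine Locally.lift_mono m (hb.2.bind ?_)
      rintro T f (h | ⟨x, hx⟩)
      · exact Locally.of_sigma_ne X (i := ⟨false⟩) (j := ⟨true⟩) (by simp) (f ≫ b) (f ≫ b)
          (by simpa using h) _
      · rw [Category.assoc, hι] at hx
        exact Locally.of_forall fun T' g => ⟨g ≫ x, by rw [Category.assoc, hx, Category.assoc]⟩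
    exact ⟨⟨{
      Z := Q
      left := Sigma.ι X ⟨false⟩ ≫ q
      right := Sigma.ι X ⟨true⟩ ≫ q
      w := hm
      isLimit := Fork.IsLimit.mk' _ fun s => by
        have h := hlift s.ι s.condition
        exact ⟨h.choose, h.choose_spec, fun hl => by
          rw [← cancel_mono m]
          exact hl.trans h.choose_spec.symm⟩ }⟩⟩

instance InfinitaryPretopos.isRegularEpi_of_epi {X Y : C} (f : X ⟶ Y) [Epi f] :
    IsRegularEpi f := by
  have : ExtremalEpi f :=
    { isIso := fun p i fac _ => by
        have : Epi (p ≫ i) := fac ▸ ‹Epi f›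
        have := epi_of_epi p i
        exact isIso_of_mono_of_epi i }
  infer_instance

theorem Locally.of_epi {T T₀ : C} (p : T₀ ⟶ T) [Epi p] :
    Locally T (fun _ f => ∃ g, g ≫ p = f) :=
  Locally.of_isRegularEpi p

end Balanced

section Words

variable {C : Type u} [Category.{v} C] {I : Type v} {R P : C}

/-- Words whose letters are pairs of an index and a generalized element of `R`. -/
abbrev StageWord (I : Type v) (R T : C) : Type v := FreeMonoid (I × (T ⟶ R))

namespace StageWord

/-- The restriction of words along a morphism of stages. -/
def restrict {T T' : C} (g : T' ⟶ T) : StageWord I R T →* StageWord I R T' :=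
  FreeMonoid.map fun a => (a.1, g ≫ a.2)

theorem restrict_of {T T' : C} (g : T' ⟶ T) (a : I × (T ⟶ R)) :
    restrict g (FreeMonoid.of a) = FreeMonoid.of (a.1, g ≫ a.2) :=
  FreeMonoid.map_of _ _

theorem restrict_restrict {T T' T'' : C} (g : T' ⟶ T) (h : T'' ⟶ T') (l : StageWord I R T) :
    restrict h (restrict g l) = restrict (h ≫ g) l := by
  induction l using FreeMonoid.inductionOn' with
  | one => simp
  | of_mul a l ih => simp [restrict_of, ih]

theorem restrict_id {T : C} (l : StageWord I R T) : restrict (𝟙 T) l = l := by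
  induction l using FreeMonoid.inductionOn' with
  | one => simp
  | of_mul a l ih => simp [restrict_of, ih]

end StageWord

/-- The congruence on words generated by a set of relations with parameters from `P`. -/
def stageCon (rels : Set (StageWord I R P × StageWord I R P)) (T : C) : Con (StageWord I R T) :=
  conGen fun a b => ∃ l ∈ rels, ∃ t : T ⟶ P, a = .restrict t l.1 ∧ b = .restrict t l.2

theorem stageCon_of_mem {rels : Set (StageWord I R P × StageWord I R P)}
    {l : StageWord I R P × StageWord I R P} (hl : l ∈ rels) {T : C} (t : T ⟶ P) :
    stageCon rels T (.restrict t l.1) (.restrict t l.2) :=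
  ConGen.Rel.of _ _ ⟨l, hl, t, rfl, rfl⟩

theorem stageCon_restrict {rels : Set (StageWord I R P × StageWord I R P)} {T T' : C}
    (g : T' ⟶ T) {a b : StageWord I R T} (h : stageCon rels T a b) :
    stageCon rels T' (.restrict g a) (.restrict g b) := by
  refine (Con.conGen_le (c := Con.comap (StageWord.restrict g) (map_mul _)
    (stageCon rels T'))).mpr ?_ h
  rintro _ _ ⟨l, hl, t, rfl, rfl⟩
  change stageCon rels T' _ _
  rw [StageWord.restrict_restrict, StageWord.restrict_restrict]
  exact stageCon_of_mem hl (g ≫ t)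

/-- The morphisms `θ` from words to `Q` exhibit `Q` as the quotient, in the internal logic, of the
words by the congruence that locally is given by `r`. -/
structure IsWordQuotient (r : ∀ T : C, Con (StageWord I R T)) {Q : C}
    (θ : ∀ {T : C}, StageWord I R T → (T ⟶ Q)) : Prop where
  comp {T T' : C} (g : T' ⟶ T) (l : StageWord I R T) : g ≫ θ l = θ (.restrict g l)
  eq_iff {T : C} {l l' : StageWord I R T} :
    θ l = θ l' ↔ Locally T fun T' f => r T' (.restrict f l) (.restrict f l')
  exists_word {T : C} (a : T ⟶ Q) : Locally T fun T' f => ∃ l : StageWord I R T', θ l = f ≫ a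

section Objects

variable [CartesianMonoidalCategory C]

/-- The product of copies of `R`. -/
def powObj (R : C) : List I → C
  | [] => 𝟙_ C
  | _ :: w => R ⊗ powObj R w

/-- The generalized element of a power of `R` given by a word. -/
def wordCode {T : C} : List (I × (T ⟶ R)) → Σ w : List I, (T ⟶ powObj R w)
  | [] => ⟨[], toUnit T⟩
  | a :: l => ⟨a.1 :: (wordCode l).1, lift a.2 (wordCode l).2⟩

/-- The word given by a generalized element of a power of `R`. -/
def wordDecode {T : C} : (w : List I) → (T ⟶ powObj R w) → List (I × (T ⟶ R))
  | [], _ => []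
  | i :: w, a => (i, a ≫ fst R (powObj R w)) :: wordDecode w (a ≫ snd R (powObj R w))

theorem wordDecode_wordCode {T : C} (l : List (I × (T ⟶ R))) :
    wordDecode (wordCode l).1 (wordCode l).2 = l := by
  induction l with
  | nil => rfl
  | cons a l ih =>
    change (a.1, lift a.2 (wordCode l).2 ≫ fst R (powObj R _)) ::
      wordDecode _ (lift a.2 (wordCode l).2 ≫ snd R (powObj R _)) = _
    rw [lift_fst, lift_snd, ih]

theorem wordCode_wordDecode {T : C} (w : List I) (a : T ⟶ powObj R w) :
    wordCode (wordDecode w a) = ⟨w, a⟩ := by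
  induction w with
  | nil => exact Sigma.ext rfl (heq_of_eq (toUnit_unique _ _))
  | cons i w ih =>
    simp only [wordDecode, wordCode]
    rw [ih]
    exact Sigma.ext rfl (heq_of_eq (CartesianMonoidalCategory.hom_ext _ _ (lift_fst _ _)
      (lift_snd _ _)))

theorem wordCode_restrict {T T' : C} (g : T' ⟶ T) (l : StageWord I R T) :
    wordCode (StageWord.restrict g l).toList =
      ⟨(wordCode l.toList).1, g ≫ (wordCode l.toList).2⟩ := by
  induction l using FreeMonoid.inductionOn' with
  | one => exact Sigma.ext rfl (heq_of_eq (toUnit_unique _ _))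
  | of_mul a l ih =>
    rw [map_mul, StageWord.restrict_of, FreeMonoid.toList_of_mul, FreeMonoid.toList_of_mul]
    simp only [wordCode]
    rw [ih]
    exact Sigma.ext rfl (heq_of_eq (comp_lift _ _ _).symm)

variable [InfinitaryPretopos C]

/-- The object of words. -/
noncomputable abbrev wordObj (I : Type v) (R : C) : C := ∐ (powObj R : List I → C)

/-- The generalized element of the object of words given by a word. -/
noncomputable def wordHom {T : C} (l : StageWord I R T) : T ⟶ wordObj I R :=
  (wordCode l.toList).2 ≫ Sigma.ι (powObj R : List I → C) (wordCode l.toList).1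

theorem comp_wordHom {T T' : C} (g : T' ⟶ T) (l : StageWord I R T) :
    g ≫ wordHom l = wordHom (.restrict g l) := by
  rw [wordHom, wordHom, wordCode_restrict]
  exact (Category.assoc _ _ _).symm

theorem Locally.of_wordHom_eq {T : C} {l l' : StageWord I R T} (h : wordHom l = wordHom l') :
    Locally T fun _ f => StageWord.restrict f l = StageWord.restrict f l' := by
  have hl := wordDecode_wordCode l.toList
  have hl' := wordDecode_wordCode l'.toList
  unfold wordHom at h
  generalize wordCode l.toList = s at h hl
  generalize wordCode l'.toList = s' at h hl'
  obtain ⟨w, a⟩ := s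
  obtain ⟨w', a'⟩ := s'
  by_cases hw : w = w'
  · subst hw
    have := InfinitaryPretopos.mono_sigma_ι (powObj R : List I → C) w
    have haa : a = a' := (cancel_mono (Sigma.ι (powObj R) w)).mp h
    have : l = l' := FreeMonoid.toList.injective (by rw [← hl, ← hl', haa])
    exact Locally.of_forall fun _ _ => by rw [this]
  · exact Locally.of_sigma_ne _ hw a a' h _

theorem isWordQuotient_wordHom :
    IsWordQuotient (fun _ : C => ⊥) (fun {T} => wordHom (I := I) (R := R) (T := T)) where
  comp := comp_wordHom
  eq_iff := ⟨Locally.of_wordHom_eq, fun h => Locally.eq (h.mono fun T f (hf : _ = _) => by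
    rw [comp_wordHom, comp_wordHom, hf])⟩
  exists_word a := (Locally.of_sigma _ a).mono fun T f ⟨w, b, hb⟩ =>
    ⟨.ofList (wordDecode w b), by
      rw [wordHom, FreeMonoid.toList_ofList, wordCode_wordDecode]
      exact hb⟩

end Objects

namespace IsWordQuotient

variable {r : ∀ T : C, Con (StageWord I R T)} {Q : C} {θ : ∀ {T : C}, StageWord I R T → (T ⟶ Q)}

theorem exists_mul [CartesianMonoidalCategory C] (hθ : IsWordQuotient r θ) :
    ∃ m : Q ⊗ Q ⟶ Q, ∀ {T : C} (l l' : StageWord I R T), lift (θ l) (θ l') ≫ m = θ (l * l') := by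
  obtain ⟨m, hm⟩ := Locally.exists_desc (F := fun T => StageWord I R T × StageWord I R T)
    (fun l => lift (θ l.1) (θ l.2)) (fun l => θ (l.1 * l.2))
    (fun g l => ⟨(.restrict g l.1, .restrict g l.2),
      by rw [comp_lift, hθ.comp, hθ.comp], by rw [hθ.comp, map_mul]⟩)
    (fun l l' e => by
      have e₁ := congr($e ≫ fst Q Q)
      have e₂ := congr($e ≫ snd Q Q)
      rw [lift_fst, lift_fst, hθ.eq_iff] at e₁
      rw [lift_snd, lift_snd, hθ.eq_iff] at e₂
      refine hθ.eq_iff.mpr ((e₁.and e₂).mono fun T f h => ?_)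
      rw [map_mul (StageWord.restrict f), map_mul (StageWord.restrict f)]
      exact Con.mul _ h.1 h.2)
    (((hθ.exists_word (fst Q Q)).and (hθ.exists_word (snd Q Q))).mono fun T f h => by
      obtain ⟨⟨l, hl⟩, l', hl'⟩ := h
      exact ⟨(l, l'), CartesianMonoidalCategory.hom_ext _ _ (by simpa using hl)
        (by simpa using hl')⟩)
  exact ⟨m, fun l l' => hm (l, l')⟩

theorem exists_monObj [CartesianMonoidalCategory C] (hθ : IsWordQuotient r θ) :
    ∃ _ : MonObj Q, (∀ {T : C}, θ (1 : StageWord I R T) = 1) ∧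
      ∀ {T : C} (l l' : StageWord I R T), θ (l * l') = θ l * θ l' := by
  obtain ⟨m, hm⟩ := hθ.exists_mul
  have hone : ∀ {T T' : C} (f : T ⟶ T'), f ≫ θ 1 = θ 1 := fun f => by rw [hθ.comp, map_one]
  refine ⟨{ one := θ 1, mul := m, one_mul := ?_, mul_one := ?_, mul_assoc := ?_ },
    (hone _).symm, fun l l' => (hm l l').symm⟩
  · refine Locally.eq ((hθ.exists_word (snd (𝟙_ C) Q)).mono ?_)
    rintro T f ⟨l, hl⟩
    obtain rfl : f = lift (toUnit T) (θ l) :=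
      CartesianMonoidalCategory.hom_ext _ _ (toUnit_unique _ _) (by simp [hl])
    rw [lift_whiskerRight_assoc, hone, hm, one_mul, lift_leftUnitor_hom]
  · refine Locally.eq ((hθ.exists_word (fst Q (𝟙_ C))).mono ?_)
    rintro T f ⟨l, hl⟩
    obtain rfl : f = lift (θ l) (toUnit T) :=
      CartesianMonoidalCategory.hom_ext _ _ (by simp [hl]) (toUnit_unique _ _)
    rw [lift_whiskerLeft_assoc, hone, hm, mul_one, lift_rightUnitor_hom]
  · refine Locally.eq ((((hθ.exists_word (fst (Q ⊗ Q) Q ≫ fst Q Q)).and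
      (hθ.exists_word (fst (Q ⊗ Q) Q ≫ snd Q Q))).and (hθ.exists_word (snd (Q ⊗ Q) Q))).mono ?_)
    rintro T f ⟨⟨⟨l₁, h₁⟩, ⟨l₂, h₂⟩⟩, ⟨l₃, h₃⟩⟩
    obtain rfl : f = lift (lift (θ l₁) (θ l₂)) (θ l₃) := CartesianMonoidalCategory.hom_ext _ _
      (CartesianMonoidalCategory.hom_ext _ _ (by simp [h₁]) (by simp [h₂])) (by simp [h₃])
    rw [lift_whiskerRight_assoc, hm, hm, lift_lift_associator_hom_assoc, lift_whiskerLeft_assoc,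
      hm, hm, mul_assoc]

end IsWordQuotient

end Words

section WordRelations

variable {C : Type u} [Category.{v} C] [CartesianMonoidalCategory C] [InfinitaryPretopos C]
  {I : Type v} {R P T : C} (rels : Set (StageWord I R P × StageWord I R P))

/-- The congruence on the generalized elements of the object of words generated by `rels`. -/
noncomputable def wordSetoid (T : C) : Setoid (T ⟶ wordObj I R) where
  r a b := Locally T fun T' f => ∃ l l' : StageWord I R T', wordHom l = f ≫ a ∧
    wordHom l' = f ≫ b ∧ stageCon rels T' l l'
  iseqv :=
    { refl := fun a => (isWordQuotient_wordHom.exists_word a).mono fun _ _ ⟨l, hl⟩ =>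
        ⟨l, l, hl, hl, Con.refl _ _⟩
      symm := fun h => h.mono fun _ _ ⟨l, l', hl, hl', h⟩ => ⟨l', l, hl', hl, Con.symm _ h⟩
      trans := fun h h' => (h.and h').bind <| by
        rintro T' f ⟨⟨l₁, l₂, h₁, h₂, h₁₂⟩, l₃, l₄, h₃, h₄, h₃₄⟩
        refine (Locally.of_wordHom_eq (h₂.trans h₃.symm)).mono fun T'' g e => ?_
        refine ⟨.restrict g l₁, .restrict g l₄, ?_, ?_, ?_⟩
        · rw [← comp_wordHom, h₁, Category.assoc]
        · rw [← comp_wordHom, h₄, Category.assoc]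
        · refine Con.trans _ (stageCon_restrict g h₁₂) ?_
          rw [e]
          exact stageCon_restrict g h₃₄ }

variable {rels}

theorem wordSetoid_comp {T' : C} (g : T' ⟶ T) {a b : T ⟶ wordObj I R}
    (h : wordSetoid rels T a b) : wordSetoid rels T' (g ≫ a) (g ≫ b) :=
  (Locally.pullback h g).mono fun _ _ ⟨l, l', hl, hl', h⟩ =>
    ⟨l, l', by simpa using hl, by simpa using hl', h⟩

theorem wordSetoid_wordHom_iff {l l' : StageWord I R T} :
    wordSetoid rels T (wordHom l) (wordHom l') ↔
      Locally T fun T' f => stageCon rels T' (.restrict f l) (.restrict f l') := by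
  constructor
  · intro h
    refine Locally.bind h ?_
    rintro T' f ⟨m, m', hm, hm', h⟩
    rw [comp_wordHom] at hm hm'
    refine ((Locally.of_wordHom_eq hm).and (Locally.of_wordHom_eq hm')).mono ?_
    rintro T'' g ⟨e, e'⟩
    rw [← StageWord.restrict_restrict, ← StageWord.restrict_restrict, ← e, ← e']
    exact stageCon_restrict g h
  · exact fun h => h.mono fun T' f h => ⟨_, _, (comp_wordHom _ _).symm, (comp_wordHom _ _).symm, h⟩

variable (rels) in
/-- The formal derivations of consequences of a set of relations. They are needed to enumerate the
consequences by a set, since subobjects need not form one. -/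
inductive WordDerivation : Type v
  | of (l : rels)
  | refl
  | symm (d : WordDerivation)
  | trans (d d' : WordDerivation)
  | mul (d d' : WordDerivation)

namespace WordDerivation

/-- The instances of a derivation, with the two words whose equality it derives. -/
noncomputable def span (m : wordObj I R ⊗ wordObj I R ⟶ wordObj I R) :
    WordDerivation rels → Σ S : C, (S ⟶ wordObj I R) × (S ⟶ wordObj I R)
  | of l => ⟨P, wordHom l.1.1, wordHom l.1.2⟩
  | refl => ⟨wordObj I R, 𝟙 _, 𝟙 _⟩
  | symm d => ⟨(d.span m).1, (d.span m).2.2, (d.span m).2.1⟩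
  | trans d d' => ⟨Limits.pullback (d.span m).2.2 (d'.span m).2.1,
      pullback.fst _ _ ≫ (d.span m).2.1, pullback.snd _ _ ≫ (d'.span m).2.2⟩
  | mul d d' => ⟨(d.span m).1 ⊗ (d'.span m).1, ((d.span m).2.1 ⊗ₘ (d'.span m).2.1) ≫ m,
      ((d.span m).2.2 ⊗ₘ (d'.span m).2.2) ≫ m⟩

variable {m : wordObj I R ⊗ wordObj I R ⟶ wordObj I R}
  (hm : ∀ {T : C} (l l' : StageWord I R T), lift (wordHom l) (wordHom l') ≫ m = wordHom (l * l'))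

include hm

theorem wordSetoid_span (d : WordDerivation rels) :
    wordSetoid rels _ (d.span m).2.1 (d.span m).2.2 := by
  induction d with
  | of l =>
    exact wordSetoid_wordHom_iff.mpr (Locally.of_forall fun _ f => stageCon_of_mem l.2 f)
  | refl => exact (wordSetoid rels _).refl _
  | symm d ih => exact (wordSetoid rels _).symm ih
  | trans d d' ih ih' =>
    refine (wordSetoid rels _).trans (wordSetoid_comp (pullback.fst _ _) ih) ?_
    rw [pullback.condition]
    exact wordSetoid_comp _ ih'
  | mul d d' ih ih' =>
    refine (Locally.and (wordSetoid_comp (fst _ _) ih) (wordSetoid_comp (snd _ _) ih')).mono ?_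
    rintro T f ⟨⟨l₁, l₂, h₁, h₂, h₁₂⟩, ⟨l₃, l₄, h₃, h₄, h₃₄⟩⟩
    refine ⟨l₁ * l₃, l₂ * l₄, ?_, ?_, Con.mul _ h₁₂ h₃₄⟩
    · rw [← hm, h₁, h₃]
      change _ = f ≫ (_ ⊗ₘ _) ≫ m
      rw [← lift_fst_comp_snd_comp, comp_lift_assoc]
    · rw [← hm, h₂, h₄]
      change _ = f ≫ (_ ⊗ₘ _) ≫ m
      rw [← lift_fst_comp_snd_comp, comp_lift_assoc]

theorem exists_of_stageCon {l l' : StageWord I R T} (h : stageCon rels T l l') :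
    ∃ (d : WordDerivation rels) (t : T ⟶ (d.span m).1),
      t ≫ (d.span m).2.1 = wordHom l ∧ t ≫ (d.span m).2.2 = wordHom l' := by
  change ConGen.Rel _ l l' at h
  induction h with
  | of a b h =>
    obtain ⟨l, hl, t, rfl, rfl⟩ := h
    exact ⟨.of ⟨l, hl⟩, t, comp_wordHom _ _, comp_wordHom _ _⟩
  | refl a => exact ⟨.refl, wordHom a, Category.comp_id _, Category.comp_id _⟩
  | symm _ ih =>
    obtain ⟨d, t, h, h'⟩ := ih
    exact ⟨.symm d, t, h', h⟩
  | trans _ _ ih ih' =>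
    obtain ⟨d, t, h₁, h₂⟩ := ih
    obtain ⟨d', t', h₁', h₂'⟩ := ih'
    refine ⟨.trans d d', pullback.lift t t' (h₂.trans h₁'.symm), ?_, ?_⟩
    · exact (pullback.lift_fst_assoc _ _ _ _).trans h₁
    · exact (pullback.lift_snd_assoc _ _ _ _).trans h₂'
  | mul _ _ ih ih' =>
    obtain ⟨d, t, h₁, h₂⟩ := ih
    obtain ⟨d', t', h₁', h₂'⟩ := ih'
    refine ⟨.mul d d', lift t t', ?_, ?_⟩
    · change lift t t' ≫ (_ ⊗ₘ _) ≫ m = _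
      rw [lift_map_assoc, h₁, h₁', hm]
    · change lift t t' ≫ (_ ⊗ₘ _) ≫ m = _
      rw [lift_map_assoc, h₂, h₂', hm]

theorem wordSetoid_iff_spanRel (a b : T ⟶ wordObj I R) : wordSetoid rels T a b ↔
    SpanRel (Sigma.desc fun d : WordDerivation rels => (d.span m).2.1)
      (Sigma.desc fun d : WordDerivation rels => (d.span m).2.2) a b := by
  rw [spanRel_sigma_desc]
  constructor
  · intro h
    refine Locally.mono h ?_
    rintro T' f ⟨l, l', hl, hl', h⟩
    obtain ⟨d, t, h₁, h₂⟩ := exists_of_stageCon hm h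
    exact ⟨d, t, h₁.trans hl, h₂.trans hl'⟩
  · intro h
    refine Locally.bind h ?_
    rintro T' f ⟨d, t, h₁, h₂⟩
    refine Locally.mono (wordSetoid_comp t (d.wordSetoid_span hm)) ?_
    rintro T'' g ⟨l, l', hl, hl', h⟩
    exact ⟨l, l', by rw [hl, h₁, Category.assoc], by rw [hl', h₂, Category.assoc], h⟩

end WordDerivation

variable (rels) in
theorem exists_isWordQuotient_stageCon :
    ∃ (Q : C) (θ : ∀ {T : C}, StageWord I R T → (T ⟶ Q)), IsWordQuotient (stageCon rels) θ := by
  obtain ⟨m, hm⟩ := isWordQuotient_wordHom.exists_mul (I := I) (R := R)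
  obtain ⟨Q, q, hq, hQ⟩ := exists_quotient_of_setoid _ _ (wordSetoid rels)
    (WordDerivation.wordSetoid_iff_spanRel hm)
  refine ⟨Q, fun l => wordHom l ≫ q, fun g l => ?_,
    fun {_ _ _} => (hQ _ _).trans wordSetoid_wordHom_iff, fun a => ?_⟩
  · rw [← Category.assoc, comp_wordHom]
  · refine ((Locally.of_isRegularEpi q).pullback a).bind ?_
    rintro T' f ⟨g, hg⟩
    refine (isWordQuotient_wordHom.exists_word g).mono ?_
    rintro T'' k ⟨l, hl⟩
    refine ⟨l, ?_⟩
    change wordHom l ≫ q = _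
    rw [hl, Category.assoc, Category.assoc, hg]

end WordRelations

section PresentedGroups

variable {C : Type u} [Category.{v} C] [CartesianMonoidalCategory C] {I : Type v} {R P : C}

theorem isMonHom_of_comp {G H : C} [MonObj G] [MonObj H] (f : G ⟶ H)
    (h₁ : ∀ T : C, (1 : T ⟶ G) ≫ f = 1)
    (h₂ : ∀ {T : C} (a b : T ⟶ G), (a * b) ≫ f = (a ≫ f) * (b ≫ f)) : IsMonHom f where
  one_hom := by simpa only [← MonObj.one_eq_one] using h₁ (𝟙_ C)
  mul_hom := by
    rw [← lift_fst_comp_snd_comp, ← Hom.mul_def, ← h₂, ← MonObj.mul_eq_mul]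

/-- The value of a word on a family of morphisms to a monoid object. -/
def StageWord.eval {H : C} [MonObj H] (y : I → (R ⟶ H)) (T : C) : StageWord I R T →* (T ⟶ H) :=
  FreeMonoid.lift fun a => a.2 ≫ y a.1

theorem StageWord.eval_of {H : C} [MonObj H] (y : I → (R ⟶ H)) {T : C} (a : I × (T ⟶ R)) :
    eval y T (FreeMonoid.of a) = a.2 ≫ y a.1 :=
  FreeMonoid.lift_eval_of _ _

theorem StageWord.eval_restrict {H : C} [MonObj H] (y : I → (R ⟶ H)) {T T' : C} (g : T' ⟶ T)
    (l : StageWord I R T) : eval y T' (restrict g l) = g ≫ eval y T l := by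
  induction l using FreeMonoid.inductionOn' with
  | one => rw [map_one, map_one, map_one, MonObj.comp_one]
  | of_mul a l ih =>
    rw [map_mul, map_mul, map_mul, restrict_of, eval_of, eval_of, ih, MonObj.comp_mul,
      Category.assoc]

theorem StageWord.eval_comp {G H : C} [MonObj G] [MonObj H] (x : I → (R ⟶ G)) (f : G ⟶ H)
    [IsMonHom f] {T : C} (l : StageWord I R T) :
    eval x T l ≫ f = eval (fun i => x i ≫ f) T l := by
  induction l using FreeMonoid.inductionOn' with
  | one => rw [map_one, map_one, MonObj.one_comp]
  | of_mul a l ih => rw [map_mul, map_mul, eval_of, eval_of, MonObj.mul_comp, ih, Category.assoc]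

theorem StageWord.eval_eq_of_stageCon {H : C} [MonObj H] (y : I → (R ⟶ H))
    {rels : Set (StageWord I R P × StageWord I R P)}
    (hy : ∀ l ∈ rels, eval y P l.1 = eval y P l.2) {T : C} {a b : StageWord I R T}
    (h : stageCon rels T a b) : eval y T a = eval y T b := by
  refine (Con.conGen_le (c := Con.ker (eval y T))).mpr ?_ h
  rintro _ _ ⟨l, hl, t, rfl, rfl⟩
  rw [Con.ker_rel, eval_restrict, eval_restrict, hy l hl]

theorem StageWord.isUnit_eval {H : C} [MonObj H] (y : I → (R ⟶ H)) {T : C}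
    (h : ∀ (i : I) (p : T ⟶ R), IsUnit (p ≫ y i)) (l : StageWord I R T) :
    IsUnit (eval y T l) := by
  induction l using FreeMonoid.inductionOn' with
  | one => rw [map_one]; exact isUnit_one
  | of_mul a l ih => rw [map_mul, eval_of]; exact (h _ _).mul ih

theorem IsWordQuotient.existsUnique_isMonHom {r : ∀ T : C, Con (StageWord I R T)} {Q H : C}
    [MonObj Q] [MonObj H] {x : I → (R ⟶ Q)}
    (hx : IsWordQuotient r fun {T} l => StageWord.eval x T l) (y : I → (R ⟶ H))
    (hy : ∀ {T : C} {l l' : StageWord I R T}, r T l l' →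
      StageWord.eval y T l = StageWord.eval y T l') :
    ∃! f : Q ⟶ H, IsMonHom f ∧ ∀ i, x i ≫ f = y i := by
  have hex : Locally Q fun T f => ∃ l : StageWord I R T, StageWord.eval x T l = f :=
    (hx.exists_word (𝟙 Q)).mono fun T f ⟨l, hl⟩ => ⟨l, hl.trans (Category.comp_id f)⟩
  obtain ⟨F, hF⟩ := Locally.exists_desc (fun {T} l => StageWord.eval x T l)
    (fun {T} l => StageWord.eval y T l)
    (fun g l => ⟨.restrict g l, (StageWord.eval_restrict x g l).symm,
      (StageWord.eval_restrict y g l).symm⟩)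
    (fun l l' h => Locally.eq ((hx.eq_iff.mp h).mono fun T f h => by
      rw [← StageWord.eval_restrict, ← StageWord.eval_restrict, hy h])) hex
  refine ⟨F, ⟨isMonHom_of_comp F (fun T => ?_) (fun a b => ?_), fun i => ?_⟩, ?_⟩
  · rw [← map_one (StageWord.eval x T), hF, map_one]
  · refine Locally.eq (((hx.exists_word a).and (hx.exists_word b)).mono ?_)
    rintro T f ⟨⟨l, hl⟩, l', hl'⟩
    rw [MonObj.comp_mul, ← Category.assoc, ← Category.assoc, ← Category.assoc, MonObj.comp_mul,
      ← hl, ← hl', ← map_mul, hF, hF, hF, map_mul]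
  · have h := hF (.of (i, 𝟙 R))
    rwa [StageWord.eval_of, StageWord.eval_of, Category.id_comp, Category.id_comp] at h
  · rintro F' ⟨_, hF'⟩
    refine Locally.eq (hex.mono ?_)
    rintro T _ ⟨l, rfl⟩
    rw [hF, StageWord.eval_comp]
    simp only [hF']

theorem exists_inv_of_locally_isUnit {Q : C} [MonObj Q]
    (h : Locally Q fun T (f : T ⟶ Q) => IsUnit f) :
    ∃ i : Q ⟶ Q, ∀ {T : C} (a : (T ⟶ Q)ˣ), (a : T ⟶ Q) ≫ i = (a⁻¹ : (T ⟶ Q)ˣ) :=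
  Locally.exists_desc (fun {T} (a : (T ⟶ Q)ˣ) => (a : T ⟶ Q))
    (fun {T} (a : (T ⟶ Q)ˣ) => ((a⁻¹ : (T ⟶ Q)ˣ) : T ⟶ Q))
    (fun g a => ⟨⟨g ≫ a, g ≫ ↑a⁻¹, by rw [← MonObj.comp_mul, a.mul_inv, MonObj.comp_one],
      by rw [← MonObj.comp_mul, a.inv_mul, MonObj.comp_one]⟩, rfl, rfl⟩)
    (fun a b hab => by rw [Units.ext hab]) h

/-- The group structure on a monoid object whose generalized elements are locally invertible. -/
noncomputable abbrev grpObjOfLocallyIsUnit {Q : C} [MonObj Q]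
    (h : Locally Q fun T (f : T ⟶ Q) => IsUnit f) : GrpObj Q where
  inv := (exists_inv_of_locally_isUnit h).choose
  left_inv := Locally.eq (h.mono fun T f ⟨a, ha⟩ => by
    rw [comp_lift_assoc, Category.comp_id, ← ha, (exists_inv_of_locally_isUnit h).choose_spec]
    exact a.inv_mul.trans (MonObj.comp_one _).symm)
  right_inv := Locally.eq (h.mono fun T f ⟨a, ha⟩ => by
    rw [comp_lift_assoc, Category.comp_id, ← ha, (exists_inv_of_locally_isUnit h).choose_spec]
    exact a.mul_inv.trans (MonObj.comp_one _).symm)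

variable [InfinitaryPretopos C]

theorem exists_isWordQuotient_eval (rels : Set (StageWord I R P × StageWord I R P)) :
    ∃ (Q : C) (_ : MonObj Q) (x : I → (R ⟶ Q)),
      IsWordQuotient (stageCon rels) fun {T} l => StageWord.eval x T l := by
  obtain ⟨Q, θ, hθ⟩ := exists_isWordQuotient_stageCon rels
  obtain ⟨_, hone, hmul⟩ := hθ.exists_monObj
  have heval : @θ = fun T l => StageWord.eval (fun i => θ (.of (i, 𝟙 R))) T l := by
    funext T l
    induction l using FreeMonoid.inductionOn' with
    | one => rw [hone, map_one]
    | of_mul a l ih =>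
      rw [hmul, map_mul, ih, StageWord.eval_of, hθ.comp, StageWord.restrict_of, Category.comp_id]
  exact ⟨Q, _, _, heval ▸ hθ⟩

theorem exists_presented_grpObj (rels : Set (StageWord I R P × StageWord I R P))
    (hinv : ∀ (T : C) (a : I × (T ⟶ R)), ∃ b : StageWord I R T,
      stageCon rels T (.of a * b) 1 ∧ stageCon rels T (b * .of a) 1) :
    ∃ (G : C) (_ : GrpObj G) (x : I → (R ⟶ G)),
      (∀ l ∈ rels, StageWord.eval x P l.1 = StageWord.eval x P l.2) ∧
      ∀ (H : C) [MonObj H] (y : I → (R ⟶ H)),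
        (∀ l ∈ rels, StageWord.eval y P l.1 = StageWord.eval y P l.2) →
        ∃! f : G ⟶ H, IsMonHom f ∧ ∀ i, x i ≫ f = y i := by
  obtain ⟨Q, _, x, hx⟩ := exists_isWordQuotient_eval rels
  have hcon : ∀ {T : C} {a b : StageWord I R T}, stageCon rels T a b →
      StageWord.eval x T a = StageWord.eval x T b :=
    fun h => hx.eq_iff.mpr (Locally.of_forall fun _ f => stageCon_restrict f h)
  have hunit : Locally Q fun T (f : T ⟶ Q) => IsUnit f := (hx.exists_word (𝟙 Q)).mono <| by
    rintro T f ⟨l, hl⟩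
    rw [← Category.comp_id f, ← hl]
    refine StageWord.isUnit_eval x (fun i p => ?_) l
    obtain ⟨b, hb, hb'⟩ := hinv T (i, p)
    rw [← StageWord.eval_of x (i, p)]
    exact ⟨⟨_, StageWord.eval x T b, by rw [← map_mul, hcon hb, map_one],
      by rw [← map_mul, hcon hb', map_one]⟩, rfl⟩
  refine ⟨Q, grpObjOfLocallyIsUnit hunit, x, fun l hl => hcon ?_, fun H _ y hy =>
    hx.existsUnique_isMonHom y (StageWord.eval_eq_of_stageCon y hy)⟩
  simpa only [StageWord.restrict_id] using stageCon_of_mem hl (𝟙 P)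

end PresentedGroups

section MapAdd

variable {A H : Type*} [AddGroup A] [Group H] {F : A → H}

theorem map_zero_of_map_add (hF : ∀ a b, F (a + b) = F a * F b) : F 0 = 1 :=
  map_one (MonoidHom.mk' (fun a : Multiplicative A => F a.toAdd) hF)

theorem map_zsmul_of_map_add (hF : ∀ a b, F (a + b) = F a * F b) (n : ℤ) (a : A) :
    F (n • a) = F a ^ n :=
  map_zpow (MonoidHom.mk' (fun a : Multiplicative A => F a.toAdd) hF) (.ofAdd a) n

end MapAdd

theorem zpow_units_inj {H : Type*} [Group H] {g h : H} (s : ℤˣ) :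
    g ^ (s : ℤ) = h ^ (s : ℤ) ↔ g = h := by
  obtain rfl | rfl := Int.units_eq_one_or s <;> simp

namespace NonUnitalRingObj

variable {C : Type u} [Category.{v} C] [CartesianMonoidalCategory C] {R : C} [NonUnitalRingObj R]
  {T T' : C}

theorem comp_add (g : T' ⟶ T) (p q : T ⟶ R) : g ≫ (p + q) = g ≫ p + g ≫ q :=
  AddMonObj.comp_add g p q

theorem comp_zero (g : T' ⟶ T) : g ≫ (0 : T ⟶ R) = 0 :=
  AddMonObj.comp_zero g

theorem comp_mul (g : T' ⟶ T) (p q : T ⟶ R) : g ≫ (p * q) = (g ≫ p) * (g ≫ q) :=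
  comp_lift_assoc _ _ _ _

theorem comp_zsmul (g : T' ⟶ T) (n : ℤ) (p : T ⟶ R) : g ≫ (n • p) = n • (g ≫ p) :=
  map_zsmul ({ toFun := fun p => g ≫ p, map_zero' := comp_zero g, map_add' := comp_add g } :
    (T ⟶ R) →+ (T' ⟶ R)) n p

end NonUnitalRingObj

section RootRelations

variable {C : Type u} [Category.{v} C] [CartesianMonoidalCategory C]

/-- Relations of Steinberg type between morphisms `x i : R ⟶ G`: each `x i` is additive, the
commutator of `x i` and `x j` is given by `x k` with the sign `s` if `mulRel i j k s` holds, and it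
is trivial if `comRel i j` holds. This covers both the linear and the simply laced case. -/
structure RootRelations {I : Type w} (mulRel : I → I → I → ℤˣ → Prop) (comRel : I → I → Prop)
    {R G : C} [NonUnitalRingObj R] [GrpObj G] (x : I → (R ⟶ G)) : Prop where
  add (i : I) {T : C} (p q : T ⟶ R) : (p ≫ x i) * (q ≫ x i) = (p + q) ≫ x i
  commutator (i j k : I) (s : ℤˣ) (h : mulRel i j k s) {T : C} (p q : T ⟶ R) :
    ⁅p ≫ x i, q ≫ x j⁆ = ((s : ℤ) • (p * q)) ≫ x k
  commute (i j : I) (h : comRel i j) {T : C} (p q : T ⟶ R) : ⁅p ≫ x i, q ≫ x j⁆ = 1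

/-- The group object `G` is presented by generators `x i` and relations of Steinberg type. -/
structure IsRootGroup {I : Type w} (mulRel : I → I → I → ℤˣ → Prop) (comRel : I → I → Prop)
    {R G : C} [NonUnitalRingObj R] [GrpObj G] (x : I → (R ⟶ G)) : Prop where
  relations : RootRelations mulRel comRel x
  universal (H : C) [GrpObj H] (y : I → (R ⟶ H)) (hy : RootRelations mulRel comRel y) :
    ∃! f : G ⟶ H, IsMonHom f ∧ ∀ i : I, x i ≫ f = y i

namespace RootRelations

variable {I : Type w} {mulRel : I → I → I → ℤˣ → Prop} {comRel : I → I → Prop}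
    {R G : C} [NonUnitalRingObj R] [GrpObj G] {x : I → (R ⟶ G)}

theorem zero_comp (h : RootRelations mulRel comRel x) (i : I) {T : C} :
    (0 : T ⟶ R) ≫ x i = 1 :=
  map_zero_of_map_add (F := fun p : T ⟶ R => p ≫ x i) fun p q => (h.add i p q).symm

theorem zsmul_comp (h : RootRelations mulRel comRel x) (i : I) {T : C} (n : ℤ) (p : T ⟶ R) :
    (n • p) ≫ x i = (p ≫ x i) ^ n :=
  map_zsmul_of_map_add (F := fun p : T ⟶ R => p ≫ x i) (fun p q => (h.add i p q).symm) n p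

theorem comp_equiv {I' : Type w₁} (e : I' ≃ I) :
    RootRelations (fun i j k s => mulRel (e i) (e j) (e k) s) (fun i j => comRel (e i) (e j))
      (fun i => x (e i)) ↔ RootRelations mulRel comRel x where
  mp h :=
    { add := fun i T p q => by simpa using h.add (e.symm i) p q
      commutator := fun i j k s hs T p q => by
        simpa using h.commutator (e.symm i) (e.symm j) (e.symm k) s (by simpa using hs) p q
      commute := fun i j hs T p q => by
        simpa using h.commute (e.symm i) (e.symm j) (by simpa using hs) p q }
  mpr h :=
    { add := fun i => h.add (e i)
      commutator := fun i j k s hs => h.commutator _ _ _ s hs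
      commute := fun i j hs => h.commute _ _ hs }

end RootRelations

section Existence

variable {I : Type v} (mulRel : I → I → I → ℤˣ → Prop) (comRel : I → I → Prop)
  (R : C) [NonUnitalRingObj R]

/-- The relations of Steinberg type as pairs of words whose letters have as parameters expressions
in the two coordinates of `R ⊗ R`. -/
inductive RootWordRel : StageWord I R (R ⊗ R) × StageWord I R (R ⊗ R) → Prop
  | zero (i : I) : RootWordRel (.of (i, 0), 1)
  | add (i : I) :
    RootWordRel (.of (i, fst R R) * .of (i, snd R R), .of (i, fst R R + snd R R))
  | commutator (i j k : I) (s : ℤˣ) (h : mulRel i j k s) :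
    RootWordRel (.of (i, fst R R) * .of (j, snd R R),
      .of (k, (s : ℤ) • (fst R R * snd R R)) * .of (j, snd R R) * .of (i, fst R R))
  | commute (i j : I) (h : comRel i j) :
    RootWordRel (.of (i, fst R R) * .of (j, snd R R), .of (j, snd R R) * .of (i, fst R R))

variable {mulRel comRel R}

theorem RootWordRel.eval_eq {G : C} [GrpObj G] {x : I → (R ⟶ G)}
    (hx : RootRelations mulRel comRel x) {l : StageWord I R (R ⊗ R) × StageWord I R (R ⊗ R)}
    (hl : RootWordRel mulRel comRel R l) :
    StageWord.eval x (R ⊗ R) l.1 = StageWord.eval x (R ⊗ R) l.2 := by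
  cases hl <;> simp only [map_mul, map_one, StageWord.eval_of]
  case zero i => exact hx.zero_comp i
  case add i => exact hx.add i _ _
  case commutator i j k s h =>
    rw [← hx.commutator i j k s h, commutatorElement_def]
    group
  case commute i j h => exact commutatorElement_eq_one_iff_mul_comm.mp (hx.commute i j h _ _)

theorem rootRelations_of_eval_eq {G : C} [GrpObj G] {x : I → (R ⟶ G)}
    (h : ∀ l, RootWordRel mulRel comRel R l →
      StageWord.eval x (R ⊗ R) l.1 = StageWord.eval x (R ⊗ R) l.2) :
    RootRelations mulRel comRel x := by
  have hT {T : C} (p q : T ⟶ R) (l) (hl : RootWordRel mulRel comRel R l) :=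
    congr(lift p q ≫ $(h l hl))
  simp only [← StageWord.eval_restrict] at hT
  refine ⟨fun i T p q => ?_, fun i j k s hs T p q => ?_, fun i j hs T p q => ?_⟩
  · simpa only [map_mul, StageWord.restrict_of, StageWord.eval_of, NonUnitalRingObj.comp_add,
      lift_fst, lift_snd] using hT p q _ (.add i)
  · have := hT p q _ (.commutator i j k s hs)
    simp only [map_mul, StageWord.restrict_of, StageWord.eval_of, NonUnitalRingObj.comp_zsmul,
      NonUnitalRingObj.comp_mul, lift_fst, lift_snd] at this
    rw [commutatorElement_def, this]
    group
  · have := hT p q _ (.commute i j hs)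
    simp only [map_mul, StageWord.restrict_of, StageWord.eval_of, lift_fst, lift_snd] at this
    rwa [commutatorElement_eq_one_iff_mul_comm]

theorem stageCon_rootWordRel_of_add_eq_zero {T : C} (i : I) {p q : T ⟶ R} (h : p + q = 0) :
    stageCon {l | RootWordRel mulRel comRel R l} T (.of (i, p) * .of (i, q)) 1 := by
  have hadd := stageCon_of_mem (rels := {l | RootWordRel mulRel comRel R l}) (.add i) (lift p q)
  have hzero := stageCon_of_mem (rels := {l | RootWordRel mulRel comRel R l}) (.zero i) (lift p q)
  simp only [map_mul, map_one, StageWord.restrict_of, NonUnitalRingObj.comp_add,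
    NonUnitalRingObj.comp_zero, lift_fst, lift_snd, h] at hadd hzero
  exact Con.trans _ hadd hzero

variable [InfinitaryPretopos C]

variable (mulRel comRel R) in
theorem exists_isRootGroup_of_small :
    ∃ (G : C) (_ : GrpObj G) (x : I → (R ⟶ G)), IsRootGroup mulRel comRel x := by
  obtain ⟨G, hG, x, hx, hu⟩ := exists_presented_grpObj {l | RootWordRel mulRel comRel R l}
    fun T a => ⟨.of (a.1, -a.2), stageCon_rootWordRel_of_add_eq_zero a.1 (add_neg_cancel _),
      stageCon_rootWordRel_of_add_eq_zero a.1 (neg_add_cancel _)⟩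
  exact ⟨G, hG, x, rootRelations_of_eval_eq hx, fun H _ y hy => hu H y fun _ hl => hl.eval_eq hy⟩

end Existence

theorem exists_isRootGroup [InfinitaryPretopos C] {I : Type w} [Finite I]
    (mulRel : I → I → I → ℤˣ → Prop) (comRel : I → I → Prop) (R : C) [NonUnitalRingObj R] :
    ∃ (G : C) (_ : GrpObj G) (x : I → (R ⟶ G)), IsRootGroup mulRel comRel x := by
  obtain ⟨n, ⟨e⟩⟩ := Finite.exists_equiv_fin I
  let e' : ULift.{v} (Fin n) ≃ I := Equiv.ulift.trans e.symm
  obtain ⟨G, hG, x, hx⟩ := exists_isRootGroup_of_small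
    (fun i j k s => mulRel (e' i) (e' j) (e' k) s) (fun i j => comRel (e' i) (e' j)) R
  refine ⟨G, hG, fun i => x (e'.symm i), ?_, fun H _ y hy => ?_⟩
  · rw [← RootRelations.comp_equiv e']
    simpa only [Equiv.symm_apply_apply] using hx.relations
  · obtain ⟨f, ⟨hf, hf'⟩, hu⟩ := hx.universal H (fun i => y (e' i))
      ((RootRelations.comp_equiv e').mpr hy)
    refine ⟨f, ⟨hf, fun i => by simpa using hf' (e'.symm i)⟩, fun f' ⟨h, h'⟩ => ?_⟩
    exact hu f' ⟨h, fun i => by simpa using h' (e' i)⟩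

end RootRelations

section Commutators

variable {G : Type*} [Group G]

theorem commutatorElement_mul_mul {y z : G} (hy : ∀ g, Commute y g) (hz : ∀ g, Commute z g)
    (a b : G) : ⁅y * a, z * b⁆ = ⁅a, b⁆ := by
  calc ⁅y * a, z * b⁆ = y * (a * z) * b * a⁻¹ * y⁻¹ * b⁻¹ * z⁻¹ := by
        rw [commutatorElement_def]; group
    _ = y * (z * (a * b * a⁻¹)) * y⁻¹ * b⁻¹ * z⁻¹ := by rw [← (hz a).eq]; group
    _ = z * (a * b * a⁻¹) * b⁻¹ * z⁻¹ := by rw [(hy _).eq]; group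
    _ = z * ⁅a, b⁆ * z⁻¹ := by rw [commutatorElement_def]; group
    _ = ⁅a, b⁆ := by rw [(hz _).eq, mul_inv_cancel_right]

theorem commute_commutatorElement {b u v : G} (hu : ∀ g, Commute ⁅b, u⁆ g)
    (hv : ∀ g, Commute ⁅b, v⁆ g) : Commute b ⁅u, v⁆ := by
  have hconj (g : G) : b * g * b⁻¹ = ⁅b, g⁆ * g := by rw [commutatorElement_def]; group
  refine mul_inv_eq_iff_eq_mul.mp ?_
  rw [conjugate_commutatorElement, hconj, hconj, commutatorElement_mul_mul hu hv]

/-- The Hall–Witt identity, solved for a conjugate. -/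
theorem conj_inv_commutatorElement {a b c : G} (hac : ∀ g, Commute ⁅a, c⁆ g) :
    a * ⁅b, c⁆⁻¹ * a⁻¹ = c * ⁅a, b⁆ * c⁻¹ * ⁅b, c⁆⁻¹ * ⁅a, b⁆⁻¹ := by
  calc a * ⁅b, c⁆⁻¹ * a⁻¹
      = ⁅a, c⁆ * (c * a * b * (c * a)⁻¹) * (c * a * c⁻¹ * b⁻¹ * a⁻¹) := by
        simp only [commutatorElement_def]; group
    _ = (c * a * b * (c * a)⁻¹) * ⁅a, c⁆ * (c * a * c⁻¹ * b⁻¹ * a⁻¹) := by rw [(hac _).eq]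
    _ = c * ⁅a, b⁆ * c⁻¹ * ⁅b, c⁆⁻¹ * ⁅a, b⁆⁻¹ := by simp only [commutatorElement_def]; group

theorem commutatorElement_assoc_iff {a b c : G} (hac : ∀ g, Commute ⁅a, c⁆ g)
    (h : Commute ⁅b, c⁆ ⁅a, ⁅b, c⁆⁆) :
    ⁅a, ⁅b, c⁆⁆ = ⁅⁅a, b⁆, c⁆ ↔ Commute ⁅a, b⁆ ⁅b, c⁆ := by
  have hl : ⁅a, ⁅b, c⁆⁆⁻¹ = c * ⁅a, b⁆ * c⁻¹ * (⁅b, c⁆⁻¹ * (⁅a, b⁆⁻¹ * ⁅b, c⁆)) := by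
    calc ⁅a, ⁅b, c⁆⁆⁻¹ = ⁅b, c⁆⁻¹ * (⁅b, c⁆ * ⁅a, ⁅b, c⁆⁆⁻¹) := (inv_mul_cancel_left _ _).symm
      _ = ⁅b, c⁆⁻¹ * (⁅a, ⁅b, c⁆⁆⁻¹ * ⁅b, c⁆) := by rw [h.inv_right.eq]
      _ = a * ⁅b, c⁆⁻¹ * a⁻¹ * ⁅b, c⁆ := by rw [commutatorElement_def a]; group
      _ = _ := by rw [conj_inv_commutatorElement hac]; group
  have hr : ⁅⁅a, b⁆, c⁆⁻¹ = c * ⁅a, b⁆ * c⁻¹ * ⁅a, b⁆⁻¹ := by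
    rw [commutatorElement_inv, commutatorElement_def c]
  rw [← inv_inj, hl, hr, mul_right_inj, inv_mul_eq_iff_eq_mul, ← Commute.inv_left_iff]
  rfl

end Commutators

section CentralExtensions

variable {C : Type u} [Category.{v} C] [CartesianMonoidalCategory C]

theorem commutatorElement_comp {G H : C} [GrpObj G] [GrpObj H] (f : G ⟶ H) [IsMonHom f]
    {T : C} (a b : T ⟶ G) : ⁅a, b⁆ ≫ f = ⁅a ≫ f, b ≫ f⁆ := by
  simp only [commutatorElement_def, MonObj.mul_comp, GrpObj.inv_comp]

theorem comp_commutatorElement {G : C} [GrpObj G] {T T' : C} (g : T' ⟶ T) (a b : T ⟶ G) :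
    g ≫ ⁅a, b⁆ = ⁅g ≫ a, g ≫ b⁆ := by
  simp only [commutatorElement_def, MonObj.comp_mul, GrpObj.comp_inv]

theorem commute_of_locally [InfinitaryPretopos C] {X T : C} [GrpObj X] {a b : T ⟶ X}
    (h : Locally T fun _ g => Commute (g ≫ a) (g ≫ b)) : Commute a b :=
  Locally.eq (h.mono fun _ g hg => by rw [MonObj.comp_mul, MonObj.comp_mul, hg.eq])

/-- All lifts of the values of two morphisms to `G` along `f` commute. -/
def LiftsCommute {R X G : C} [GrpObj X] (f : X ⟶ G) (x y : R ⟶ G) : Prop :=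
  ∀ ⦃T : C⦄ (a b : T ⟶ X) (p q : T ⟶ R), a ≫ f = p ≫ x → b ≫ f = q ≫ y → Commute a b

theorem LiftsCommute.symm {R X G : C} [GrpObj X] {f : X ⟶ G} {x y : R ⟶ G}
    (h : LiftsCommute f x y) : LiftsCommute f y x :=
  fun _ a b p q ha hb => (h b a q p hb ha).symm

theorem LiftsCommute.comp {R X G : C} [GrpObj X] {f : X ⟶ G} {x y : R ⟶ G}
    (h : LiftsCommute f x y) {T : C} (p q : T ⟶ R) : LiftsCommute f (p ≫ x) (q ≫ y) :=
  fun _ a b p' q' ha hb => h a b (p' ≫ p) (q' ≫ q) (ha.trans (Category.assoc _ _ _).symm)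
    (hb.trans (Category.assoc _ _ _).symm)

variable {X G : C} [GrpObj X] [GrpObj G] {f : X ⟶ G}

namespace IsCentralExtension

variable (hf : IsCentralExtension f)

include hf

theorem commutatorElement_congr {T : C} {a a' b b' : T ⟶ X} (ha : a ≫ f = a' ≫ f)
    (hb : b ≫ f = b' ≫ f) : ⁅a, b⁆ = ⁅a', b'⁆ := by
  have := hf.isMonHom
  obtain ⟨y, rfl⟩ : ∃ y, y * a' = a := ⟨a / a', div_mul_cancel _ _⟩
  obtain ⟨z, rfl⟩ : ∃ z, z * b' = b := ⟨b / b', div_mul_cancel _ _⟩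
  rw [MonObj.mul_comp, mul_eq_right] at ha hb
  exact commutatorElement_mul_mul (hf.central y · ha) (hf.central z · hb) a' b'

theorem commute_congr {T : C} {a a' b b' : T ⟶ X} (ha : a ≫ f = a' ≫ f)
    (hb : b ≫ f = b' ≫ f) : Commute a b ↔ Commute a' b' := by
  simp only [← commutatorElement_eq_one_iff_commute, hf.commutatorElement_congr ha hb]

variable [InfinitaryPretopos C]

theorem exists_lift {T : C} (a : T ⟶ G) : Locally T fun _ g => ∃ b, b ≫ f = g ≫ a :=
  have := hf.epi
  (Locally.of_epi f).pullback a

theorem exists_bracket : ∃ κ : G ⊗ G ⟶ X, ∀ {T : C} (a b : T ⟶ X),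
    lift (a ≫ f) (b ≫ f) ≫ κ = ⁅a, b⁆ := by
  obtain ⟨κ, hκ⟩ := Locally.exists_desc (F := fun T => (T ⟶ X) × (T ⟶ X))
    (fun l => lift (l.1 ≫ f) (l.2 ≫ f)) (fun l => ⁅l.1, l.2⁆)
    (fun g l => ⟨(g ≫ l.1, g ≫ l.2), by rw [comp_lift, Category.assoc, Category.assoc],
      comp_commutatorElement g _ _⟩)
    (fun l l' h => hf.commutatorElement_congr (by simpa using congr($h ≫ fst _ _))
      (by simpa using congr($h ≫ snd _ _)))
    (((hf.exists_lift (fst G G)).and (hf.exists_lift (snd G G))).mono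
      fun T g ⟨⟨a, ha⟩, ⟨b, hb⟩⟩ =>
        ⟨(a, b), by rw [ha, hb, ← comp_lift, lift_fst_snd, Category.comp_id]⟩)
  exact ⟨κ, fun a b => hκ (a, b)⟩

/-- The commutator of lifts to the central extension. -/
noncomputable def bracket {T : C} (a b : T ⟶ G) : T ⟶ X :=
  lift a b ≫ hf.exists_bracket.choose

theorem bracket_comp_comp {T : C} (a b : T ⟶ X) : hf.bracket (a ≫ f) (b ≫ f) = ⁅a, b⁆ :=
  hf.exists_bracket.choose_spec a b

theorem comp_bracket {T T' : C} (g : T' ⟶ T) (a b : T ⟶ G) :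
    g ≫ hf.bracket a b = hf.bracket (g ≫ a) (g ≫ b) :=
  comp_lift_assoc _ _ _ _

theorem bracket_comp {T : C} (a b : T ⟶ G) : hf.bracket a b ≫ f = ⁅a, b⁆ := by
  have := hf.isMonHom
  refine Locally.eq (((hf.exists_lift a).and (hf.exists_lift b)).mono ?_)
  rintro T' g ⟨⟨a', ha⟩, ⟨b', hb⟩⟩
  rw [← Category.assoc, hf.comp_bracket, comp_commutatorElement, ← ha, ← hb,
    hf.bracket_comp_comp, commutatorElement_comp]

theorem bracket_inv {T : C} (a b : T ⟶ G) : (hf.bracket a b)⁻¹ = hf.bracket b a := by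
  refine Locally.eq (((hf.exists_lift a).and (hf.exists_lift b)).mono ?_)
  rintro T' g ⟨⟨a', ha⟩, ⟨b', hb⟩⟩
  rw [GrpObj.comp_inv, hf.comp_bracket, hf.comp_bracket, ← ha, ← hb, hf.bracket_comp_comp,
    hf.bracket_comp_comp, commutatorElement_inv]

theorem bracket_mul_left {T : C} {a a' b : T ⟶ G} (h : LiftsCommute f ⁅a', b⁆ a) :
    hf.bracket (a * a') b = hf.bracket a' b * hf.bracket a b := by
  have := hf.isMonHom
  refine Locally.eq (((hf.exists_lift a).and ((hf.exists_lift a').and (hf.exists_lift b))).mono ?_)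
  rintro T' g ⟨⟨u, hu⟩, ⟨u', hu'⟩, ⟨v, hv⟩⟩
  have hcom : Commute ⁅u', v⁆ u :=
    h _ _ g g (by rw [commutatorElement_comp, hu', hv, comp_commutatorElement]) hu
  rw [hf.comp_bracket, MonObj.comp_mul, MonObj.comp_mul, hf.comp_bracket, hf.comp_bracket, ← hu,
    ← hu', ← hv, ← MonObj.mul_comp, hf.bracket_comp_comp, hf.bracket_comp_comp,
    hf.bracket_comp_comp]
  calc ⁅u * u', v⁆ = u * ⁅u', v⁆ * u⁻¹ * ⁅u, v⁆ := by simp only [commutatorElement_def]; group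
    _ = ⁅u', v⁆ * ⁅u, v⁆ := by rw [← hcom.eq, mul_inv_cancel_right]

theorem bracket_mul_right {T : C} {a b b' : T ⟶ G} (h : LiftsCommute f ⁅b', a⁆ b) :
    hf.bracket a (b * b') = hf.bracket a b * hf.bracket a b' := by
  rw [← hf.bracket_inv, hf.bracket_mul_left h, mul_inv_rev, hf.bracket_inv, hf.bracket_inv]

theorem commute_of_comp_eq_commutatorElement {T : C} {b c : T ⟶ X} {u v : T ⟶ G}
    (hu : Commute (b ≫ f) u) (hv : Commute (b ≫ f) v) (hc : c ≫ f = ⁅u, v⁆) : Commute b c := by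
  have := hf.isMonHom
  refine commute_of_locally (((hf.exists_lift u).and (hf.exists_lift v)).mono ?_)
  rintro T' g ⟨⟨u', hu'⟩, ⟨v', hv'⟩⟩
  have hone {w : T ⟶ G} (hw : Commute (b ≫ f) w) {w' : T' ⟶ X} (hw' : w' ≫ f = g ≫ w) :
      ⁅g ≫ b, w'⁆ ≫ f = 1 := by
    rw [commutatorElement_comp, hw', Category.assoc, ← comp_commutatorElement,
      commutatorElement_eq_one_iff_commute.mpr hw, MonObj.comp_one]
  have hcomp : (g ≫ c) ≫ f = ⁅u', v'⁆ ≫ f := by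
    rw [Category.assoc, hc, comp_commutatorElement, commutatorElement_comp, hu', hv']
  exact (hf.commute_congr rfl hcomp).mpr
    (commute_commutatorElement (hf.central _ · (hone hu hu')) (hf.central _ · (hone hv hv')))

end IsCentralExtension

end CentralExtensions

section WeakUnits

variable {C : Type u} [Category.{v} C] [CartesianMonoidalCategory C] [InfinitaryPretopos C]
  {R : C} [NonUnitalRingObj R]

/-- A family of maps `F` on pairs of generalized elements of a ring object that behaves like a map
on `R ⊗_R R` and therefore factors through the multiplication if there is a weak unit. Additivity
in the first variable suffices. -/
structure IsBalanced {X : C} [GrpObj X] (F : ∀ {T : C}, (T ⟶ R) → (T ⟶ R) → (T ⟶ X)) :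
    Prop where
  comp {T T' : C} (g : T' ⟶ T) (p q : T ⟶ R) : g ≫ F p q = F (g ≫ p) (g ≫ q)
  add {T : C} (p p' q : T ⟶ R) : F (p + p') q = F p q * F p' q
  mul {T : C} (p q r : T ⟶ R) : F (p * q) r = F p (q * r)

namespace IsWeakUnit

variable {E : Subobject R} (hE : IsWeakUnit E)

include hE

theorem exists_mul_eq {T : C} (p : T ⟶ R) :
    Locally T fun T' f => ∃ s e : T' ⟶ R, E.Factors e ∧ s * e = f ≫ p := by
  have := hE.epi_mul
  refine ((Locally.of_epi (fst R (E : C) * (snd R (E : C) ≫ E.arrow))).pullback p).mono ?_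
  rintro T' f ⟨g, hg⟩
  refine ⟨g ≫ fst _ _, g ≫ snd _ _ ≫ E.arrow, ?_, ?_⟩
  · rw [← Category.assoc]
    exact Subobject.factors_of_factors_right _ (Subobject.factors_self E)
  · rw [← hg, NonUnitalRingObj.comp_mul]

theorem exists_mul_eq_mul_eq {T : C} (p q : T ⟶ R) :
    Locally T fun T' f => ∃ s t e : T' ⟶ R, E.Factors e ∧ s * e = f ≫ p ∧ t * e = f ≫ q := by
  refine ((hE.exists_mul_eq p).and (hE.exists_mul_eq q)).bind ?_
  rintro T' f ⟨⟨s, a, ha, hs⟩, ⟨t, b, hb, ht⟩⟩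
  obtain ⟨T'', g, hg, z, a', b', hz, -, -, hza, hzb⟩ := hE.exists_common_divisor a b ha hb
  refine (Locally.of_epi g).mono ?_
  rintro T₃ k ⟨l, rfl⟩
  refine ⟨l ≫ (g ≫ s * a'), l ≫ (g ≫ t * b'), l ≫ z, ?_, ?_, ?_⟩
  · exact Subobject.factors_of_factors_right _ hz
  · rw [← NonUnitalRingObj.comp_mul, mul_assoc, ← hza, ← NonUnitalRingObj.comp_mul, hs]
    simp only [Category.assoc]
  · rw [← NonUnitalRingObj.comp_mul, mul_assoc, ← hzb, ← NonUnitalRingObj.comp_mul, ht]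
    simp only [Category.assoc]

theorem exists_mul_eq_eq_mul {T : C} (a b : T ⟶ R) :
    Locally T fun T' f => ∃ p q r : T' ⟶ R, p * q = f ≫ a ∧ q * r = f ≫ b :=
  (hE.exists_mul_eq_mul_eq a b).mono fun _ _ ⟨s, t, e, he, hs, ht⟩ =>
    ⟨s, e, t, hs, by rw [hE.central e t he, ht]⟩

variable {X : C} [GrpObj X] {F : ∀ {T : C}, (T ⟶ R) → (T ⟶ R) → (T ⟶ X)}
  (hF : IsBalanced F)

include hF

omit [InfinitaryPretopos C] in
theorem balanced_eq_one {T : C} {p e : T ⟶ R} (he : E.Factors e) (h : p * e = 0) :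
    F p e = 1 := by
  obtain ⟨T', g, hg, a', a'', -, -, ha, hp⟩ := hE.exists_factor_of_mul_eq_zero p e he h
  rw [← cancel_epi g, hF.comp, ha, ← hF.mul, hp, MonObj.comp_one]
  exact map_zero_of_map_add (F := fun p : T' ⟶ R => F p a'') fun p p' => hF.add p p' a''

theorem balanced_congr {T : C} {p q p' q' : T ⟶ R} (h : p * q = p' * q') : F p q = F p' q' := by
  refine Locally.eq ((hE.exists_mul_eq_mul_eq q q').mono ?_)
  rintro T' f ⟨s, s', e, he, hs, hs'⟩
  have hzero : (f ≫ p * s - f ≫ p' * s') * e = 0 := by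
    rw [sub_mul, mul_assoc, hs, mul_assoc, hs', ← NonUnitalRingObj.comp_mul,
      ← NonUnitalRingObj.comp_mul, h, sub_self]
  rw [hF.comp, hF.comp, ← hs, ← hs', ← hF.mul, ← hF.mul,
    ← sub_add_cancel (f ≫ p * s) (f ≫ p' * s'), hF.add, hE.balanced_eq_one hF he hzero, one_mul]

theorem exists_balanced_eq_mul_comp :
    ∃ y : R ⟶ X, ∀ ⦃T : C⦄ (p q : T ⟶ R), F p q = (p * q) ≫ y := by
  obtain ⟨y, hy⟩ := Locally.exists_desc (F := fun T => (T ⟶ R) × (T ⟶ R)) (fun l => l.1 * l.2)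
    (fun l => F l.1 l.2)
    (fun g l => ⟨(g ≫ l.1, g ≫ l.2), NonUnitalRingObj.comp_mul g _ _, hF.comp g _ _⟩)
    (fun _ _ => hE.balanced_congr hF)
    ((hE.exists_mul_eq (𝟙 R)).mono
      fun T f ⟨p, q, _, hpq⟩ => ⟨(p, q), hpq.trans (Category.comp_id f)⟩)
  exact ⟨y, fun T p q => (hy (p, q)).symm⟩

end IsWeakUnit

end WeakUnits

section RootBracket

variable {C : Type u} [Category.{v} C] [CartesianMonoidalCategory C] [InfinitaryPretopos C]
  {R X G : C} [GrpObj X] [GrpObj G] {I : Type w} {f : X ⟶ G} (hf : IsCentralExtension f)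
  (x : I → (R ⟶ G))

/-- The commutator of lifts of the values of two root morphisms, with a sign. -/
noncomputable def rootBracket (i j : I) (s : ℤˣ) {T : C} (p q : T ⟶ R) : T ⟶ X :=
  hf.bracket (p ≫ x i) (q ≫ x j) ^ (s : ℤ)

theorem comp_rootBracket {T T' : C} (g : T' ⟶ T) (i j : I) (s : ℤˣ) (p q : T ⟶ R) :
    g ≫ rootBracket hf x i j s p q = rootBracket hf x i j s (g ≫ p) (g ≫ q) := by
  rw [rootBracket, rootBracket, GrpObj.comp_zpow, hf.comp_bracket, Category.assoc, Category.assoc]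

theorem rootBracket_swap (i j : I) (s : ℤˣ) {T : C} (p q : T ⟶ R) :
    rootBracket hf x j i (-s) q p = rootBracket hf x i j s p q := by
  rw [rootBracket, rootBracket, Units.val_neg, zpow_neg, ← inv_zpow, hf.bracket_inv]

variable {x} in
theorem commutatorElement_eq_rootBracket_zpow (i j : I) (s : ℤˣ) {T : C} {p q : T ⟶ R}
    {a b : T ⟶ X} (ha : a ≫ f = p ≫ x i) (hb : b ≫ f = q ≫ x j) :
    ⁅a, b⁆ = rootBracket hf x i j s p q ^ (s : ℤ) := by
  rw [rootBracket, ← zpow_mul, Int.units_coe_mul_self, zpow_one, ← ha, ← hb, hf.bracket_comp_comp]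

end RootBracket

section RootExtensions

variable {C : Type u} [Category.{v} C] [CartesianMonoidalCategory C] [InfinitaryPretopos C]
  {R : C} [NonUnitalRingObj R] {E : Subobject R}
  {I : Type w} {mulRel : I → I → I → ℤˣ → Prop} {comRel : I → I → Prop}
  {X G : C} [GrpObj X] [GrpObj G] {x : I → (R ⟶ G)} (hx : RootRelations mulRel comRel x)
  {f : X ⟶ G} (hf : IsCentralExtension f)

section

include hx

omit [InfinitaryPretopos C] in
theorem RootRelations.mul_comp_eq_commutatorElement {i j k : I} {s : ℤˣ} (h : mulRel i j k s)
    {T : C} (p q : T ⟶ R) : (p * q) ≫ x k = ⁅((s : ℤ) • p) ≫ x i, q ≫ x j⁆ := by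
  rw [hx.commutator i j k s h, smul_mul_assoc, smul_smul, Int.units_coe_mul_self, one_smul]

theorem liftsCommute_of_mulRel (hE : IsWeakUnit E) (hf : IsCentralExtension f) {i j k l : I}
    {s : ℤˣ} (h : mulRel k l i s) (hk : comRel k j) (hl : comRel l j) :
    LiftsCommute f (x i) (x j) := by
  intro T a b p q ha hb
  refine commute_of_locally ((hE.exists_mul_eq p).mono ?_)
  rintro T' g ⟨p', e, -, hp⟩
  have hcom {m : I} (hm : comRel m j) (r : T' ⟶ R) : Commute ((g ≫ b) ≫ f) (r ≫ x m) := by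
    rw [Category.assoc, hb, ← Category.assoc]
    exact (commutatorElement_eq_one_iff_commute.mp (hx.commute m j hm r _)).symm
  refine (hf.commute_of_comp_eq_commutatorElement (hcom hk ((s : ℤ) • p')) (hcom hl e) ?_).symm
  rw [Category.assoc, ha, ← Category.assoc, ← hp, hx.mul_comp_eq_commutatorElement h]

theorem rootBracket_comp {i j t : I} {s : ℤˣ} (h : mulRel i j t s) {T : C} (p q : T ⟶ R) :
    rootBracket hf x i j s p q ≫ f = (p * q) ≫ x t := by
  have := hf.isMonHom
  rw [rootBracket, GrpObj.zpow_comp, hf.bracket_comp, hx.commutator i j t s h, ← hx.zsmul_comp,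
    smul_smul, Int.units_coe_mul_self, one_smul]

theorem commute_bracket {i j t : I} {s : ℤˣ} (h : mulRel i j t s)
    (ht : LiftsCommute f (x t) (x t)) {T : C} (p p' q q' : T ⟶ R) :
    Commute (hf.bracket (p ≫ x i) (q ≫ x j)) (hf.bracket (p' ≫ x i) (q' ≫ x j)) :=
  ht _ _ _ _ ((hf.bracket_comp _ _).trans (hx.commutator i j t s h p q))
    ((hf.bracket_comp _ _).trans (hx.commutator i j t s h p' q'))

theorem rootBracket_add_left {i j t : I} {s : ℤˣ} (h : mulRel i j t s)
    (hi : LiftsCommute f (x t) (x i)) (ht : LiftsCommute f (x t) (x t)) {T : C}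
    (p p' q : T ⟶ R) : rootBracket hf x i j s (p + p') q =
      rootBracket hf x i j s p q * rootBracket hf x i j s p' q := by
  have hcom : LiftsCommute f ⁅p' ≫ x i, q ≫ x j⁆ (p ≫ x i) := by
    rw [hx.commutator i j t s h]
    exact hi.comp _ _
  have hcom' := commute_bracket hx hf h ht p p' q q
  rw [rootBracket, ← hx.add, hf.bracket_mul_left hcom, ← hcom'.eq, hcom'.mul_zpow]
  rfl

theorem rootBracket_add_right {i j t : I} {s : ℤˣ} (h : mulRel i j t s)
    (hj : LiftsCommute f (x t) (x j)) (ht : LiftsCommute f (x t) (x t)) {T : C}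
    (p q q' : T ⟶ R) : rootBracket hf x i j s p (q + q') =
      rootBracket hf x i j s p q * rootBracket hf x i j s p q' := by
  have hcom : LiftsCommute f ⁅q' ≫ x j, p ≫ x i⁆ (q ≫ x j) := by
    rw [← commutatorElement_inv, hx.commutator i j t s h, ← zpow_neg_one, ← hx.zsmul_comp]
    exact hj.comp _ _
  rw [rootBracket, ← hx.add, hf.bracket_mul_right hcom,
    (commute_bracket hx hf h ht p p q q').mul_zpow]
  rfl

end

/-- The indices `a`, `b`, `c` behave like roots with the sums `d = a + b`, `e = b + c` and
`t = a + b + c`, such that `a + c` is neither zero nor a root. The condition on the signs says that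
they are compatible with the Jacobi identity. -/
structure IsRootTriple (mulRel : I → I → I → ℤˣ → Prop) (comRel : I → I → Prop)
    (a b c d e t : I) (s₁ s₂ s₃ s₄ : ℤˣ) : Prop where
  left : mulRel a b d s₁
  right : mulRel b c e s₂
  add_right : mulRel a e t s₃
  left_add : mulRel d c t s₄
  sign : s₁ * s₄ = s₂ * s₃
  comRel : comRel a c

section

variable {a b c d e t : I} {s₁ s₂ s₃ s₄ : ℤˣ}
  (h : IsRootTriple mulRel comRel a b c d e t s₁ s₂ s₃ s₄)
  (htt : LiftsCommute f (x t) (x t)) (hte : LiftsCommute f (x t) (x e))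
  (htd : LiftsCommute f (x t) (x d))

include hx h htt hte htd

theorem rootBracket_mul_eq_iff {T : C} (p q r : T ⟶ R) {u v w : T ⟶ X} (hu : u ≫ f = p ≫ x a)
    (hv : v ≫ f = q ≫ x b) (hw : w ≫ f = r ≫ x c) :
    rootBracket hf x a e s₃ p (q * r) = rootBracket hf x d c s₄ (p * q) r ↔
      Commute ⁅u, v⁆ ⁅v, w⁆ := by
  have := hf.isMonHom
  have huv : ⁅u, v⁆ ≫ f = ((s₁ : ℤ) • (p * q)) ≫ x d := by
    rw [commutatorElement_comp, hu, hv, hx.commutator a b d s₁ h.left]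
  have hvw : ⁅v, w⁆ ≫ f = ((s₂ : ℤ) • (q * r)) ≫ x e := by
    rw [commutatorElement_comp, hv, hw, hx.commutator b c e s₂ h.right]
  have huvw : ⁅u, ⁅v, w⁆⁆ ≫ f = ((s₃ : ℤ) • (p * ((s₂ : ℤ) • (q * r)))) ≫ x t := by
    rw [commutatorElement_comp, hu, hvw, hx.commutator a e t s₃ h.add_right]
  have huw : ⁅u, w⁆ ≫ f = 1 := by
    rw [commutatorElement_comp, hu, hw, hx.commute a c h.comRel]
  have hright : ⁅u, ⁅v, w⁆⁆ = rootBracket hf x a e s₃ p (q * r) ^ ((s₂ * s₃ : ℤˣ) : ℤ) := by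
    rw [commutatorElement_eq_rootBracket_zpow hf a e s₃ hu hvw,
      map_zsmul_of_map_add (rootBracket_add_right hx hf h.add_right hte htt p), ← zpow_mul,
      Units.val_mul]
  have hleft : ⁅⁅u, v⁆, w⁆ = rootBracket hf x d c s₄ (p * q) r ^ ((s₁ * s₄ : ℤˣ) : ℤ) := by
    rw [commutatorElement_eq_rootBracket_zpow hf d c s₄ huv hw,
      map_zsmul_of_map_add (F := fun p => rootBracket hf x d c s₄ p r)
        fun p p' => rootBracket_add_left hx hf h.left_add htd htt p p' r, ← zpow_mul,
      Units.val_mul]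
  rw [← commutatorElement_assoc_iff (hf.central _ · huw) (hte _ _ _ _ huvw hvw).symm, hleft,
    hright, h.sign, zpow_units_inj]

theorem rootBracket_mul_eq (hde : LiftsCommute f (x d) (x e)) {T : C} (p q r : T ⟶ R) :
    rootBracket hf x a e s₃ p (q * r) = rootBracket hf x d c s₄ (p * q) r := by
  have := hf.isMonHom
  refine Locally.eq ((((hf.exists_lift (p ≫ x a)).and (hf.exists_lift (q ≫ x b))).and
    (hf.exists_lift (r ≫ x c))).mono ?_)
  rintro T' g ⟨⟨⟨u, hu⟩, ⟨v, hv⟩⟩, ⟨w, hw⟩⟩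
  rw [← Category.assoc] at hu hv hw
  rw [comp_rootBracket, comp_rootBracket, NonUnitalRingObj.comp_mul, NonUnitalRingObj.comp_mul,
    rootBracket_mul_eq_iff hx hf h htt hte htd _ _ _ hu hv hw]
  refine hde _ _ ((s₁ : ℤ) • ((g ≫ p) * (g ≫ q))) ((s₂ : ℤ) • ((g ≫ q) * (g ≫ r))) ?_ ?_
  · rw [commutatorElement_comp, hu, hv, hx.commutator a b d s₁ h.left]
  · rw [commutatorElement_comp, hv, hw, hx.commutator b c e s₂ h.right]

theorem liftsCommute_of_rootBracket_mul_eq (hE : IsWeakUnit E)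
    (hmul : ∀ {T : C} (p q r : T ⟶ R),
      rootBracket hf x a e s₃ p (q * r) = rootBracket hf x d c s₄ (p * q) r) :
    LiftsCommute f (x d) (x e) := by
  have := hf.isMonHom
  intro T y z p q hy hz
  refine commute_of_locally
    ((hE.exists_mul_eq_eq_mul ((s₁ : ℤ) • p) ((s₂ : ℤ) • q)).bind ?_)
  rintro T' g ⟨p', q', r', hp, hq⟩
  refine (((hf.exists_lift (p' ≫ x a)).and (hf.exists_lift (q' ≫ x b))).and
    (hf.exists_lift (r' ≫ x c))).mono ?_
  rintro T'' g' ⟨⟨⟨u, hu⟩, ⟨v, hv⟩⟩, ⟨w, hw⟩⟩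
  have huv : (g' ≫ g ≫ y) ≫ f = ⁅u, v⁆ ≫ f := by
    rw [commutatorElement_comp, hu, hv, ← comp_commutatorElement, hx.commutator a b d s₁ h.left,
      hp, NonUnitalRingObj.comp_zsmul, smul_smul, Int.units_coe_mul_self, one_smul]
    simp only [Category.assoc, hy]
  have hvw : (g' ≫ g ≫ z) ≫ f = ⁅v, w⁆ ≫ f := by
    rw [commutatorElement_comp, hv, hw, ← comp_commutatorElement, hx.commutator b c e s₂ h.right,
      hq, NonUnitalRingObj.comp_zsmul, smul_smul, Int.units_coe_mul_self, one_smul]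
    simp only [Category.assoc, hz]
  rw [← Category.assoc] at hu hv hw
  rw [Category.assoc, Category.assoc, hf.commute_congr huv hvw,
    ← rootBracket_mul_eq_iff hx hf h htt hte htd _ _ _ hu hv hw]
  exact hmul _ _ _

end

section Commutative

variable (hE : IsWeakUnit E) {i j k l : I} {s s' : ℤˣ}

include hE

theorem rootBracket_eq_of_mul_left
    (h : ∀ {T : C} (p q r : T ⟶ R),
      rootBracket hf x i j s (p * q) r = rootBracket hf x k l s' (p * q) r)
    {T : C} (p q : T ⟶ R) : rootBracket hf x i j s p q = rootBracket hf x k l s' p q := by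
  refine Locally.eq ((hE.exists_mul_eq p).mono ?_)
  rintro T' g ⟨a, e, -, hp⟩
  rw [comp_rootBracket, comp_rootBracket, ← hp, h]

variable (hcomm : ∀ (T : C) (p q : T ⟶ R), p * q = q * p)
  (h : ∀ {T : C} (p q r : T ⟶ R),
    rootBracket hf x i j s p (q * r) = rootBracket hf x k l s' (p * q) r)

include hcomm h

theorem rootBracket_balanced_of_comm {T : C} (p q r : T ⟶ R) :
    rootBracket hf x i j s (p * q) r = rootBracket hf x i j s p (q * r) := by
  have hswap {T : C} (p q r : T ⟶ R) :
      rootBracket hf x i j s p (q * r) = rootBracket hf x i j s q (p * r) := by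
    rw [h, h, hcomm]
  refine Locally.eq ((hE.exists_mul_eq r).mono ?_)
  rintro T' g ⟨a, e, -, hr⟩
  rw [comp_rootBracket, comp_rootBracket, NonUnitalRingObj.comp_mul, NonUnitalRingObj.comp_mul,
    ← hr, hswap, ← mul_assoc _ a, hcomm _ _ a, mul_assoc, mul_assoc, hswap _ a]

theorem rootBracket_eq_of_comm {T : C} (p q : T ⟶ R) :
    rootBracket hf x i j s p q = rootBracket hf x k l s' p q :=
  rootBracket_eq_of_mul_left hf hE
    (fun p q r => by rw [rootBracket_balanced_of_comm hf hE hcomm h, h]) p q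

end Commutative

end RootExtensions

section RootSections

variable {C : Type u} [Category.{v} C] [CartesianMonoidalCategory C] [InfinitaryPretopos C]
  {R : C} [NonUnitalRingObj R] {E : Subobject R} (hE : IsWeakUnit E)
  {I : Type w} {mulRel : I → I → I → ℤˣ → Prop} {comRel : I → I → Prop}
  {X G : C} [GrpObj X] [GrpObj G] {f : X ⟶ G} (hf : IsCentralExtension f)

/-- The bracket of lifts of the `i`-th and the `j`-th root morphism depends only on the product of
the arguments, through the morphism `y`. Then `y` is the candidate for a lift of the root morphism
of the sum of the roots. -/
def IsRootLift (x : I → (R ⟶ G)) (i j : I) (s : ℤˣ) (y : R ⟶ X) : Prop :=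
  ∀ ⦃T : C⦄ (p q : T ⟶ R), rootBracket hf x i j s p q = (p * q) ≫ y

variable {x : I → (R ⟶ G)}

include hE

theorem exists_isRootLift (hx : RootRelations mulRel comRel x) {i j t : I} {s : ℤˣ}
    (h : mulRel i j t s) (hi : LiftsCommute f (x t) (x i)) (ht : LiftsCommute f (x t) (x t))
    (hbal : ∀ {T : C} (p q r : T ⟶ R),
      rootBracket hf x i j s (p * q) r = rootBracket hf x i j s p (q * r)) :
    ∃ y : R ⟶ X, IsRootLift hf x i j s y :=
  hE.exists_balanced_eq_mul_comp (F := fun p q => rootBracket hf x i j s p q)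
    { comp := fun g p q => comp_rootBracket hf x g i j s p q
      add := fun p p' q => rootBracket_add_left hx hf h hi ht p p' q
      mul := hbal }

namespace IsRootLift

variable {hf} {i j t : I} {s : ℤˣ} {y : R ⟶ X} (hy : IsRootLift hf x i j s y)
  (hx : RootRelations mulRel comRel x) (h : mulRel i j t s)

include hy hx h

theorem comp_eq : y ≫ f = x t := by
  refine Locally.eq ((hE.exists_mul_eq (𝟙 R)).mono ?_)
  rintro T g ⟨p, e, -, hg⟩
  rw [Category.comp_id] at hg
  rw [← hg, ← Category.assoc, ← hy, rootBracket_comp hx hf h]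

theorem add_comp (hi : LiftsCommute f (x t) (x i)) (ht : LiftsCommute f (x t) (x t)) {T : C}
    (p q : T ⟶ R) : (p + q) ≫ y = (p ≫ y) * (q ≫ y) := by
  refine Locally.eq ((hE.exists_mul_eq_mul_eq p q).mono ?_)
  rintro T' g ⟨a, b, e, -, hp, hq⟩
  rw [← Category.assoc, NonUnitalRingObj.comp_add, MonObj.comp_mul, ← Category.assoc,
    ← Category.assoc, ← hp, ← hq, ← add_mul, ← hy, ← hy, ← hy, rootBracket_add_left hx hf h hi ht]

end IsRootLift

theorem RootRelations.of_isRootLift (hx : RootRelations mulRel comRel x)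
    (hdec : ∀ t, ∃ i j s, mulRel i j t s ∧ LiftsCommute f (x t) (x i))
    (htt : ∀ t, LiftsCommute f (x t) (x t))
    (hcom : ∀ i j, comRel i j → LiftsCommute f (x i) (x j))
    {y : I → (R ⟶ X)} (hy : ∀ i j t s, mulRel i j t s → IsRootLift hf x i j s (y t)) :
    RootRelations mulRel comRel y := by
  have hyf t : y t ≫ f = x t :=
    have ⟨i, j, s, h, _⟩ := hdec t
    (hy i j t s h).comp_eq hE hx h
  have hadd t {T : C} (p q : T ⟶ R) : (p + q) ≫ y t = (p ≫ y t) * (q ≫ y t) :=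
    have ⟨i, j, s, h, ht⟩ := hdec t
    (hy i j t s h).add_comp hE hx h ht (htt t) p q
  have hlift t {T : C} (p : T ⟶ R) : (p ≫ y t) ≫ f = p ≫ x t := by rw [Category.assoc, hyf]
  refine ⟨fun t _ p q => (hadd t p q).symm, fun i j t s h T p q => ?_, fun i j h _ p q =>
    commutatorElement_eq_one_iff_commute.mpr (hcom i j h _ _ p q (hlift i p) (hlift j q))⟩
  rw [map_zsmul_of_map_add (F := fun p : T ⟶ R => p ≫ y t) (hadd t), ← hy i j t s h,
    commutatorElement_eq_rootBracket_zpow hf i j s (hlift i p) (hlift j q)]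

theorem IsRootGroup.exists_section (hx : IsRootGroup mulRel comRel x)
    (hdec : ∀ t, ∃ i j s, mulRel i j t s ∧ LiftsCommute f (x t) (x i))
    (htt : ∀ t, LiftsCommute f (x t) (x t))
    (hcom : ∀ i j, comRel i j → LiftsCommute f (x i) (x j))
    (hy : ∀ t, ∃ y : R ⟶ X, ∀ i j s, mulRel i j t s → IsRootLift hf x i j s y) :
    ∃ s : G ⟶ X, IsMonHom s ∧ s ≫ f = 𝟙 G := by
  have := hf.isMonHom
  choose y hy using hy
  have hyf t : y t ≫ f = x t :=
    have ⟨i, j, s, h, _⟩ := hdec t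
    (hy t i j s h).comp_eq hE hx.relations h
  obtain ⟨s, ⟨hs, hs'⟩, -⟩ := hx.universal X y
    (hx.relations.of_isRootLift hE hf hdec htt hcom fun i j t s => hy t i j s)
  obtain ⟨_, -, hu⟩ := hx.universal G x hx.relations
  refine ⟨s, hs, ?_⟩
  rw [hu (s ≫ f) ⟨inferInstance, fun i => by rw [← Category.assoc, hs', hyf]⟩,
    hu (𝟙 G) ⟨inferInstance, fun i => Category.comp_id _⟩]

end RootSections

section LinearRoots

/-- The roots of type `A` of rank `n - 1`: the pair `(i, j)` stands for the difference of the `i`-th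
and the `j`-th coordinate. -/
abbrev LinearRoot (n : ℕ) : Type := {p : Fin n × Fin n // p.1 ≠ p.2}

namespace LinearRoot

variable {n : ℕ}

/-- The nontrivial commutator relations of type `A`, all with the sign `1`. -/
def mulRel (a b c : LinearRoot n) (s : ℤˣ) : Prop :=
  a.1.2 = b.1.1 ∧ c.1.1 = a.1.1 ∧ c.1.2 = b.1.2 ∧ s = 1

/-- The trivial commutator relations of type `A`. -/
def comRel (a b : LinearRoot n) : Prop :=
  a.1.2 ≠ b.1.1 ∧ a.1.1 ≠ b.1.2

theorem mulRel_mk {i j k : Fin n} (hij : i ≠ j) (hjk : j ≠ k) (hik : i ≠ k) :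
    mulRel ⟨(i, j), hij⟩ ⟨(j, k), hjk⟩ ⟨(i, k), hik⟩ 1 :=
  ⟨rfl, rfl, rfl, rfl⟩

theorem comRel_self (a : LinearRoot n) : comRel a a :=
  ⟨a.2.symm, a.2⟩

theorem isRootTriple {i j k l : Fin n} (hij : i ≠ j) (hjk : j ≠ k) (hkl : k ≠ l) (hik : i ≠ k)
    (hjl : j ≠ l) (hil : i ≠ l) :
    IsRootTriple mulRel comRel ⟨(i, j), hij⟩ ⟨(j, k), hjk⟩ ⟨(k, l), hkl⟩ ⟨(i, k), hik⟩
      ⟨(j, l), hjl⟩ ⟨(i, l), hil⟩ 1 1 1 1 where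
  left := mulRel_mk hij hjk hik
  right := mulRel_mk hjk hkl hjl
  add_right := mulRel_mk hij hjl hil
  left_add := mulRel_mk hik hkl hil
  sign := rfl
  comRel := ⟨hjk, hil⟩

end LinearRoot

theorem exists_ne_ne_ne_ne {α : Type*} [Fintype α] (h : 5 ≤ Fintype.card α) (i j k l : α) :
    ∃ m, m ≠ i ∧ m ≠ j ∧ m ≠ k ∧ m ≠ l := by
  classical
  obtain ⟨m, -, hm⟩ := Finset.exists_mem_notMem_of_card_lt_card
    (s := {i, j, k, l}) (t := Finset.univ) (Finset.card_le_four.trans_lt h)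
  exact ⟨m, by simpa using hm⟩

end LinearRoots

section LinearSteinbergPresentation

variable {C : Type u} [Category.{v} C] [CartesianMonoidalCategory C]
  {R : C} [NonUnitalRingObj R] {n : ℕ}

theorem linearSteinbergRelations_iff {G : C} [GrpObj G] (x : ∀ i j : Fin n, i ≠ j → (R ⟶ G)) :
    LinearSteinbergRelations x ↔
      RootRelations LinearRoot.mulRel LinearRoot.comRel
        (fun a : LinearRoot n => x a.1.1 a.1.2 a.2) where
  mp h :=
    { add := fun i => h.add _ _ i.2
      commutator := by
        rintro ⟨⟨i, j⟩, hij⟩ ⟨⟨k, l⟩, hkl⟩ ⟨⟨i', l'⟩, hil⟩ s ⟨h₁, h₂, h₃, rfl⟩ T p q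
        dsimp only at h₁ h₂ h₃
        subst h₁ h₂ h₃
        simpa using h.commutator _ _ _ hij hkl hil p q
      commute := fun i j hs => h.commute _ _ _ _ i.2 j.2 hs.1 hs.2 }
  mpr h :=
    { add := fun i j hij => h.add ⟨(i, j), hij⟩
      commutator := fun i j k hij hjk hik T p q => by
        simpa using h.commutator ⟨(i, j), hij⟩ ⟨(j, k), hjk⟩ ⟨(i, k), hik⟩ 1
          ⟨rfl, rfl, rfl, rfl⟩ p q
      commute := fun i j k l hij hkl hjk hil =>
        h.commute ⟨(i, j), hij⟩ ⟨(k, l), hkl⟩ ⟨hjk, hil⟩ }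

theorem isLinearSteinbergGroup_iff {G : C} [GrpObj G] (x : ∀ i j : Fin n, i ≠ j → (R ⟶ G)) :
    IsLinearSteinbergGroup x ↔
      IsRootGroup LinearRoot.mulRel LinearRoot.comRel
        (fun a : LinearRoot n => x a.1.1 a.1.2 a.2) where
  mp h :=
    { relations := (linearSteinbergRelations_iff x).mp h.relations
      universal := fun H _ y hy => by
        obtain ⟨g, ⟨hg, hg'⟩, hu⟩ := h.universal H (fun i j hij => y ⟨(i, j), hij⟩)
          ((linearSteinbergRelations_iff _).mpr hy)
        exact ⟨g, ⟨hg, fun i => hg' _ _ i.2⟩, fun g' h' =>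
          hu g' ⟨h'.1, fun i j hij => h'.2 ⟨(i, j), hij⟩⟩⟩ }
  mpr h :=
    { relations := (linearSteinbergRelations_iff x).mpr h.relations
      universal := fun H _ y hy => by
        obtain ⟨g, ⟨hg, hg'⟩, hu⟩ := h.universal H (fun a => y a.1.1 a.1.2 a.2)
          ((linearSteinbergRelations_iff _).mp hy)
        exact ⟨g, ⟨hg, fun i j hij => hg' ⟨(i, j), hij⟩⟩,
          fun g' h' => hu g' ⟨h'.1, fun i => h'.2 _ _ _⟩⟩ }

variable [InfinitaryPretopos C]

theorem exists_isLinearSteinbergGroup (n : ℕ) (R : C) [NonUnitalRingObj R] :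
    ∃ (G : C) (_ : GrpObj G) (x : ∀ i j : Fin n, i ≠ j → (R ⟶ G)), IsLinearSteinbergGroup x := by
  obtain ⟨G, hG, x, hx⟩ :=
    exists_isRootGroup (LinearRoot.mulRel (n := n)) LinearRoot.comRel R
  exact ⟨G, hG, fun i j hij => x ⟨(i, j), hij⟩, (isLinearSteinbergGroup_iff _).mpr hx⟩

end LinearSteinbergPresentation

section LinearSteinbergExtensions

variable {C : Type u} [Category.{v} C] [CartesianMonoidalCategory C] [InfinitaryPretopos C]
  {R : C} [NonUnitalRingObj R] {E : Subobject R} (hE : IsWeakUnit E) {n : ℕ} (hn : 5 ≤ n)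
  {X G : C} [GrpObj X] [GrpObj G] {x : LinearRoot n → (R ⟶ G)}
  (hx : RootRelations LinearRoot.mulRel LinearRoot.comRel x)
  {f : X ⟶ G} (hf : IsCentralExtension f)

include hE hn hx

namespace LinearRoot

theorem liftsCommute (hf : IsCentralExtension f) {a b : LinearRoot n} (h : comRel a b) :
    LiftsCommute f (x a) (x b) := by
  obtain ⟨⟨i, j⟩, hij⟩ := a
  obtain ⟨⟨k, l⟩, hkl⟩ := b
  obtain ⟨hjk, hil⟩ := h
  obtain ⟨m, hi, hj, hk, hl⟩ := exists_ne_ne_ne_ne (by simpa using hn) i j k l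
  exact liftsCommute_of_mulRel hx hE hf (mulRel_mk hi.symm hj hij) ⟨hk, hil⟩ ⟨hjk, hl⟩

theorem rootBracket_mul_eq {i j j' k : Fin n} (hij : i ≠ j) (hjk : j ≠ k) (hij' : i ≠ j')
    (hjk' : j' ≠ k) (hik : i ≠ k) (hjj' : j ≠ j') {T : C} (p q r : T ⟶ R) :
    rootBracket hf x ⟨(i, j), hij⟩ ⟨(j, k), hjk⟩ 1 p (q * r) =
      rootBracket hf x ⟨(i, j'), hij'⟩ ⟨(j', k), hjk'⟩ 1 (p * q) r :=
  have hcom {a b : LinearRoot n} (h : comRel a b) : LiftsCommute f (x a) (x b) :=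
    liftsCommute hE hn hx hf h
  _root_.rootBracket_mul_eq hx hf (isRootTriple hij hjj' hjk' hij' hjk hik) (hcom (comRel_self _))
    (hcom ⟨hjk.symm, hik⟩) (hcom ⟨hik.symm, hij'⟩) (hcom ⟨hjj'.symm, hik⟩) p q r

theorem rootBracket_eq {i j j' k : Fin n} (hij : i ≠ j) (hjk : j ≠ k) (hij' : i ≠ j')
    (hjk' : j' ≠ k) (hik : i ≠ k) {T : C} (p q : T ⟶ R) :
    rootBracket hf x ⟨(i, j), hij⟩ ⟨(j, k), hjk⟩ 1 p q =
      rootBracket hf x ⟨(i, j'), hij'⟩ ⟨(j', k), hjk'⟩ 1 p q := by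
  obtain ⟨m, hi, hk, hj, hj'⟩ := exists_ne_ne_ne_ne (by simpa using hn) i k j j'
  refine rootBracket_eq_of_mul_left hf hE (fun p q r => ?_) p q
  rw [← rootBracket_mul_eq hE hn hx hf hi.symm hk hij hjk hik hj,
    ← rootBracket_mul_eq hE hn hx hf hi.symm hk hij' hjk' hik hj']

theorem exists_isRootLift {i j k : Fin n} (hij : i ≠ j) (hjk : j ≠ k) (hik : i ≠ k) :
    ∃ y : R ⟶ X, IsRootLift hf x ⟨(i, j), hij⟩ ⟨(j, k), hjk⟩ 1 y := by
  obtain ⟨m, hi, hk, hj, -⟩ := exists_ne_ne_ne_ne (by simpa using hn) i k j j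
  refine _root_.exists_isRootLift hE hf hx (mulRel_mk hij hjk hik)
    (liftsCommute hE hn hx hf ⟨hik.symm, hij⟩) (liftsCommute hE hn hx hf (comRel_self _))
    fun p q r => ?_
  rw [rootBracket_eq hE hn hx hf hij hjk hi.symm hk hik,
    rootBracket_mul_eq hE hn hx hf hij hjk hi.symm hk hik hj.symm]

theorem exists_forall_isRootLift (t : LinearRoot n) :
    ∃ y : R ⟶ X, ∀ a b s, mulRel a b t s → IsRootLift hf x a b s y := by
  obtain ⟨⟨i, k⟩, hik⟩ := t
  obtain ⟨m, hi, hk, -⟩ := exists_ne_ne_ne_ne (by simpa using hn) i k i k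
  obtain ⟨y, hy⟩ := exists_isRootLift hE hn hx hf hi.symm hk hik
  refine ⟨y, ?_⟩
  rintro ⟨⟨i', j⟩, hij⟩ ⟨⟨j', k'⟩, hjk⟩ s ⟨rfl, rfl, rfl, rfl⟩ T p q
  rw [← hy, rootBracket_eq hE hn hx hf hij hjk hi.symm hk hik]

end LinearRoot

end LinearSteinbergExtensions

theorem centrallyClosed_of_isLinearSteinbergGroup {C : Type u} [Category.{v} C]
    [CartesianMonoidalCategory C] [InfinitaryPretopos C] {R : C} [NonUnitalRingObj R]
    (hR : WeaklyUnital R) {n : ℕ} (hn : 5 ≤ n) {G : C} [GrpObj G]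
    {x : ∀ i j : Fin n, i ≠ j → (R ⟶ G)} (hx : IsLinearSteinbergGroup x) : CentrallyClosed G := by
  obtain ⟨E, hE⟩ := hR
  intro X _ f hf
  have hx := (isLinearSteinbergGroup_iff x).mp hx
  have hcom a b (h : LinearRoot.comRel a b) := LinearRoot.liftsCommute hE hn hx.relations hf h
  refine hx.exists_section hE hf ?_ (fun t => hcom t t t.comRel_self) hcom
    (LinearRoot.exists_forall_isRootLift hE hn hx.relations hf)
  rintro ⟨⟨i, k⟩, hik⟩
  obtain ⟨m, hi, hk, -⟩ := exists_ne_ne_ne_ne (by simpa using hn) i k i k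
  exact ⟨_, _, 1, LinearRoot.mulRel_mk hi.symm hk hik, hcom _ _ ⟨hik.symm, hi.symm⟩⟩

section RootPairings

variable {I K M N S : Type*} [CommRing K] [AddCommGroup M] [Module K M] [AddCommGroup N]
  [Module K N] (P : RootPairing I K M N)

theorem exists_root_eq_neg (i : I) : ∃ k, P.root k = -P.root i :=
  ⟨P.reflectionPerm i i, by rw [P.root_reflectionPerm, P.reflection_apply_self]⟩

theorem exists_pairing_ne_zero_of_span_root_image_eq_top [NeZero (2 : K)] {s : Set I}
    (h : Submodule.span K (P.root '' s) = ⊤) (k : I) : ∃ i ∈ s, P.pairing i k ≠ 0 := by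
  by_contra! hs
  have hker : Submodule.span K (P.root '' s) ≤ LinearMap.ker (P.coroot' k) := by
    rw [Submodule.span_le]
    rintro _ ⟨i, hi, rfl⟩
    exact hs i hi
  have hk : P.root k ∈ LinearMap.ker (P.coroot' k) := hker (h ▸ Submodule.mem_top)
  rw [LinearMap.mem_ker, P.root_coroot'_eq_pairing, P.pairing_same] at hk
  exact two_ne_zero hk

theorem linearIndependent_root_of_det_pairing_ne_zero [IsDomain K] {ι' : Type*} [Fintype ι']
    [DecidableEq ι'] {w : ι' → I} (h : (Matrix.of fun a b => P.pairing (w a) (w b)).det ≠ 0) :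
    LinearIndependent K (P.root ∘ w) := by
  rw [Fintype.linearIndependent_iff]
  intro g hg
  refine congrFun (Matrix.eq_zero_of_vecMul_eq_zero h (funext fun b => ?_))
  simpa [Matrix.vecMul, dotProduct] using congr(P.coroot' (w b) $hg)

variable {P} [CommRing S] [Algebra S K] [FaithfulSMul S K] [P.IsValuedIn S]

theorem pairingIn_eq_sub_of_root_eq_sub {i j k : I} (h : P.root k = P.root i - P.root j) (l : I) :
    P.pairingIn S k l = P.pairingIn S i l - P.pairingIn S j l :=
  eq_sub_of_add_eq (P.pairingIn_eq_add_of_root_eq_add (by rw [h, sub_add_cancel])).symm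

theorem pairingIn_eq_neg_of_root_eq_neg {i k : I} (h : P.root k = -P.root i) (l : I) :
    P.pairingIn S k l = -P.pairingIn S i l := by
  refine FaithfulSMul.algebraMap_injective S K ?_
  rw [map_neg, P.algebraMap_pairingIn, P.algebraMap_pairingIn, ← P.root_coroot'_eq_pairing, h,
    map_neg, P.root_coroot'_eq_pairing]

variable [Finite I] [IsDomain K] [CharZero K] [P.IsCrystallographic]

theorem exists_root_eq_sub {i j : I} (h : P.pairingIn ℤ i j = 1) :
    ∃ k, P.root k = P.root i - P.root j := by
  refine P.root_sub_root_mem_of_pairingIn_pos (by omega) fun hij => ?_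
  rw [hij, P.pairingIn_same] at h
  omega

theorem exists_root_eq_add {i j : I} (h : P.pairingIn ℤ i j = -1) :
    ∃ k, P.root k = P.root i + P.root j := by
  refine P.root_add_root_mem_of_pairingIn_neg (by omega) fun hij => ?_
  rw [pairingIn_eq_neg_of_root_eq_neg hij, P.pairingIn_same] at h
  omega

end RootPairings

section SimplyLaced

variable {I : Type w₁} {M : Type w₂} {N : Type w₃} [AddCommGroup M] [Module ℝ M]
  [AddCommGroup N] [Module ℝ N] {P : RootPairing I ℝ M N} [P.IsCrystallographic]

namespace RootIsSimplyLaced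

variable (hP : RootIsSimplyLaced P)

include hP

theorem pairingIn_of_root_ne {i j : I} (h : i ≠ j) (h' : P.root i ≠ -P.root j) :
    P.pairingIn ℤ i j = 0 ∨ P.pairingIn ℤ i j = 1 ∨ P.pairingIn ℤ i j = -1 := by
  have h₀ := hP i j (P.root.injective.ne h) h'
  rw [← P.algebraMap_pairingIn ℤ, algebraMap_int_eq, eq_intCast] at h₀
  exact_mod_cast h₀

theorem eq_or_root_eq_neg_or_pairingIn (i j : I) :
    i = j ∨ P.root i = -P.root j ∨ P.pairingIn ℤ i j = 0 ∨ P.pairingIn ℤ i j = 1 ∨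
      P.pairingIn ℤ i j = -1 :=
  or_iff_not_imp_left.mpr fun h => or_iff_not_imp_left.mpr (hP.pairingIn_of_root_ne h)

theorem eq_of_pairingIn_eq_two {i j : I} (h : P.pairingIn ℤ i j = 2) : i = j := by
  obtain h' | h' | h' := hP.eq_or_root_eq_neg_or_pairingIn i j
  · exact h'
  · rw [pairingIn_eq_neg_of_root_eq_neg h', P.pairingIn_same] at h
    omega
  · omega

theorem eq_neg_of_pairingIn_eq_neg_two {i j : I} (h : P.pairingIn ℤ i j = -2) :
    P.root i = -P.root j := by
  obtain rfl | h' | h' := hP.eq_or_root_eq_neg_or_pairingIn i j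
  · rw [P.pairingIn_same] at h
    omega
  · exact h'
  · omega

theorem pairingIn_mem_Icc (i j : I) : P.pairingIn ℤ i j ∈ Set.Icc (-2) 2 := by
  obtain rfl | h | h | h | h := hP.eq_or_root_eq_neg_or_pairingIn i j
  · simp
  · simp [pairingIn_eq_neg_of_root_eq_neg h]
  all_goals simp [h]

theorem pairingIn_le_one {i j : I} (h : i ≠ j) : P.pairingIn ℤ i j ≤ 1 := by
  have h₁ := (hP.pairingIn_mem_Icc i j).2
  have h₂ : P.pairingIn ℤ i j ≠ 2 := fun h' => h (hP.eq_of_pairingIn_eq_two h')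
  omega

theorem odd_pairingIn_iff (i j : I) :
    Odd (P.pairingIn ℤ i j) ↔ P.pairingIn ℤ i j = 1 ∨ P.pairingIn ℤ i j = -1 := by
  have ⟨h₁, h₂⟩ := hP.pairingIn_mem_Icc i j
  rw [Int.odd_iff]
  omega

theorem eq_zero_of_not_odd {i j : I} (h : ¬ Odd (P.pairingIn ℤ i j)) (hij : i ≠ j)
    (hij' : P.root i ≠ -P.root j) : P.pairingIn ℤ i j = 0 := by
  rw [hP.odd_pairingIn_iff] at h
  have := hP.eq_or_root_eq_neg_or_pairingIn i j
  tauto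

theorem root_mem_span_of_pairingIn_ne_zero {i j : I} (h : P.pairingIn ℤ j i ≠ 0) :
    P.root j ∈ Submodule.span ℝ (P.root '' insert i {k | P.pairingIn ℤ k i = 1}) := by
  have mem {k} (hk : k ∈ insert i {k | P.pairingIn ℤ k i = 1}) :
      P.root k ∈ Submodule.span ℝ (P.root '' insert i {k | P.pairingIn ℤ k i = 1}) :=
    Submodule.subset_span ⟨k, hk, rfl⟩
  obtain rfl | hj | hj | hj | hj := hP.eq_or_root_eq_neg_or_pairingIn j i
  · exact mem (.inl rfl)
  · exact hj ▸ neg_mem (mem (.inl rfl))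
  · exact absurd hj h
  · exact mem (.inr hj)
  · obtain ⟨k, hk⟩ := exists_root_eq_neg P j
    have hki : P.pairingIn ℤ k i = 1 := by
      rw [pairingIn_eq_neg_of_root_eq_neg hk, hj, neg_neg]
    rw [← neg_neg (P.root j), ← hk]
    exact neg_mem (mem (.inr hki))

variable [Finite I]

theorem pairingIn_comm (i j : I) : P.pairingIn ℤ i j = P.pairingIn ℤ j i := by
  rcases eq_or_ne i j with rfl | hij
  · rfl
  rcases eq_or_ne (P.root i) (-P.root j) with hneg | hneg
  · have hneg' : P.root j = -P.root i := by rw [hneg, neg_neg]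
    rw [pairingIn_eq_neg_of_root_eq_neg hneg j, pairingIn_eq_neg_of_root_eq_neg hneg' i,
      P.pairingIn_same, P.pairingIn_same]
  have h₁ := hP.pairingIn_of_root_ne hij hneg
  have h₂ := hP.pairingIn_of_root_ne hij.symm fun h => hneg (by rw [h, neg_neg])
  have h₃ := P.pairingIn_pairingIn_mem_set_of_isCrystallographic i j
  simp only [Set.mem_insert_iff, Set.mem_singleton_iff, Prod.mk.injEq] at h₃
  omega

theorem isOrthogonal_of_pairingIn_eq_zero {i j : I} (h : P.pairingIn ℤ i j = 0) :
    P.IsOrthogonal i j :=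
  ⟨by rw [← P.algebraMap_pairingIn ℤ, h, map_zero],
    by rw [← P.algebraMap_pairingIn ℤ, ← hP.pairingIn_comm, h, map_zero]⟩

theorem pairingIn_add_right {i j k : I} (h : P.root k = P.root i + P.root j) (l : I) :
    P.pairingIn ℤ l k = P.pairingIn ℤ l i + P.pairingIn ℤ l j := by
  rw [hP.pairingIn_comm l, hP.pairingIn_comm l, hP.pairingIn_comm l,
    P.pairingIn_eq_add_of_root_eq_add h]

theorem pairingIn_eq_one_left {i j k : I} (h : P.root k = P.root i + P.root j) :
    P.pairingIn ℤ i k = 1 := by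
  have h₁ := P.pairingIn_eq_add_of_root_eq_add (S := ℤ) (j := k) h
  have h₂ := hP.pairingIn_add_right h i
  have h₃ := hP.pairingIn_add_right h j
  have h₄ := hP.pairingIn_comm i j
  rw [P.pairingIn_same] at h₁ h₂ h₃
  omega

theorem pairingIn_eq_one_right {i j k : I} (h : P.root k = P.root i + P.root j) :
    P.pairingIn ℤ j k = 1 :=
  hP.pairingIn_eq_one_left (h.trans (add_comm _ _))

theorem pairingIn_eq_neg_one {i j k : I} (h : P.root k = P.root i + P.root j) :
    P.pairingIn ℤ i j = -1 := by
  have := hP.pairingIn_add_right h i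
  rw [hP.pairingIn_eq_one_left h, P.pairingIn_same] at this
  omega

theorem exists_root_eq_add_of_pairingIn_eq_one {i t : I} (h : P.pairingIn ℤ i t = 1) :
    ∃ j, P.root t = P.root i + P.root j := by
  obtain ⟨j, hj⟩ := exists_root_eq_sub ((hP.pairingIn_comm t i).trans h)
  exact ⟨j, by rw [hj, add_sub_cancel]⟩

variable [P.IsIrreducible]

theorem span_root_image_eq_top (i : I) :
    Submodule.span ℝ (P.root '' insert i {k | P.pairingIn ℤ k i = 1}) = ⊤ := by
  refine P.span_root_image_eq_top_of_forall_orthogonal _ ⟨i, .inl rfl⟩ fun j hj k hk => ?_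
  have hji : P.pairingIn ℤ j i = 0 := not_imp_comm.mp hP.root_mem_span_of_pairingIn_ne_zero hj
  refine hP.isOrthogonal_of_pairingIn_eq_zero ?_
  rcases hk with rfl | hk
  · exact hji
  have hk : P.pairingIn ℤ k i = 1 := hk
  have mem_k := hP.root_mem_span_of_pairingIn_ne_zero (i := i) (j := k) (by omega)
  obtain rfl | hjk | hjk | hjk | hjk := hP.eq_or_root_eq_neg_or_pairingIn j k
  · exact absurd mem_k hj
  · exact absurd (hjk ▸ neg_mem mem_k) hj
  · exact hjk
  · obtain ⟨l, hl⟩ := exists_root_eq_sub hjk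
    have hli := pairingIn_eq_sub_of_root_eq_sub (S := ℤ) hl i
    refine absurd ?_ hj
    rw [← sub_add_cancel (P.root j) (P.root k), ← hl]
    exact add_mem (hP.root_mem_span_of_pairingIn_ne_zero (by omega)) mem_k
  · obtain ⟨l, hl⟩ := exists_root_eq_add hjk
    have hli := P.pairingIn_eq_add_of_root_eq_add (S := ℤ) (j := i) hl
    refine absurd ?_ hj
    rw [← add_sub_cancel_right (P.root j) (P.root k), ← hl]
    exact sub_mem (hP.root_mem_span_of_pairingIn_ne_zero (by omega)) mem_k

theorem exists_root_eq_add_notMem_span (hM : 4 ≤ Module.finrank ℝ M) (t : I) (x y : M) :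
    ∃ k l, P.root t = P.root k + P.root l ∧ P.root k ∉ Submodule.span ℝ {P.root t, x, y} ∧
      P.root l ∉ Submodule.span ℝ {P.root t, x, y} := by
  have mem_t : P.root t ∈ Submodule.span ℝ {P.root t, x, y} := Submodule.subset_span (by simp)
  obtain ⟨k, hk, hk'⟩ : ∃ k, P.pairingIn ℤ k t = 1 ∧
      P.root k ∉ Submodule.span ℝ {P.root t, x, y} := by
    by_contra! h
    have span_eq : Submodule.span ℝ {P.root t, x, y} = ⊤ := by
      rw [← top_le_iff, ← hP.span_root_image_eq_top t, Submodule.span_le]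
      rintro _ ⟨k, rfl | hk, rfl⟩
      exacts [mem_t, h k hk]
    classical
    have h₁ := finrank_span_finset_le_card (R := ℝ) ({P.root t, x, y} : Finset M)
    rw [Set.finrank, Finset.coe_insert, Finset.coe_pair, span_eq, finrank_top] at h₁
    have h₂ := Finset.card_le_three (a := P.root t) (b := x) (c := y)
    omega
  obtain ⟨l, hl⟩ := hP.exists_root_eq_add_of_pairingIn_eq_one hk
  refine ⟨k, l, hl, hk', fun hl' => hk' ?_⟩
  rw [eq_sub_of_add_eq hl.symm]
  exact sub_mem mem_t hl'

end RootIsSimplyLaced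

end SimplyLaced

section TypeD4

variable {I : Type w₁} {M : Type w₂} {N : Type w₃} [AddCommGroup M] [Module ℝ M]
  [AddCommGroup N] [Module ℝ N] {P : RootPairing I ℝ M N} [P.IsCrystallographic]

theorem rootIsTypeD4_of_pairingIn_eq [Finite I] [P.IsRootSystem] [P.IsReduced]
    {w : Fin 4 → I}
    (hw : ∀ a b, P.pairingIn ℤ (w a) (w b) = CartanMatrix.D 4 a b)
    (hmem : ∀ k, P.root k ∈ AddSubmonoid.closure (P.root '' Set.range w) ∨
      -P.root k ∈ AddSubmonoid.closure (P.root '' Set.range w)) : RootIsTypeD4 P := by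
  have hli : LinearIndependent ℝ (P.root ∘ w) := by
    refine linearIndependent_root_of_det_pairing_ne_zero P ?_
    have : (Matrix.of fun a b => P.pairing (w a) (w b)) =
        (Int.castRingHom ℝ).mapMatrix (CartanMatrix.D 4) := by
      ext a b
      rw [Matrix.of_apply, RingHom.mapMatrix_apply, Matrix.map_apply, ← hw,
        ← P.algebraMap_pairingIn ℤ, algebraMap_int_eq]
    rw [this, ← RingHom.map_det, show (CartanMatrix.D 4).det = 4 by decide]
    simp
  have hinj : Function.Injective w := hli.injective.of_comp
  let b : P.Base := RootPairing.Base.mk' P (Set.range w)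
    ((linearIndepOn_range_iff hinj P.root).mpr hli) hmem
  have hb : ∀ i, i ∈ b.support ↔ i ∈ Set.range w := by simp [b, RootPairing.Base.mk']
  let e : Fin 4 ≃ b.support :=
    (Equiv.ofInjective w hinj).trans (Equiv.subtypeEquivRight fun i => (hb i).symm)
  refine ⟨b, e.symm, ?_⟩
  ext i j
  obtain ⟨k, rfl⟩ := e.surjective i
  obtain ⟨l, rfl⟩ := e.surjective j
  rw [Matrix.submatrix_apply, e.symm_apply_apply, e.symm_apply_apply]
  exact hw k l

/-- The roots `d₁`, `d₂`, `d₃` and `c` form a Dynkin diagram of type `D₄` with the center `c`. -/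
structure IsD4Diagram (P : RootPairing I ℝ M N) [P.IsCrystallographic] (c d₁ d₂ d₃ : I) :
    Prop where
  pairingIn₁₂ : P.pairingIn ℤ d₁ d₂ = 0
  pairingIn₁₃ : P.pairingIn ℤ d₁ d₃ = 0
  pairingIn₂₃ : P.pairingIn ℤ d₂ d₃ = 0
  pairingIn₁ : P.pairingIn ℤ c d₁ = -1
  pairingIn₂ : P.pairingIn ℤ c d₂ = -1
  pairingIn₃ : P.pairingIn ℤ c d₃ = -1

/-- Two roots are joined to the same roots: in the simply laced case, an odd pairing is `1` or `-1`,
so these are the roots that are neither proportional nor orthogonal to them. -/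
def HasSameNeighbors (P : RootPairing I ℝ M N) [P.IsCrystallographic] (i j : I) : Prop :=
  ∀ k, Odd (P.pairingIn ℤ k i) ↔ Odd (P.pairingIn ℤ k j)

variable [Finite I] (hP : RootIsSimplyLaced P)

include hP

theorem RootIsSimplyLaced.exists_pairingIn_eq_neg_one_of_odd {k d : I}
    (h : Odd (P.pairingIn ℤ k d)) :
    ∃ (k' : I) (e : ℕ), e ≤ 1 ∧ P.root k = P.root k' + e • P.root d ∧ P.pairingIn ℤ k' d = -1 ∧
      ∀ l, P.pairingIn ℤ d l = 0 → P.pairingIn ℤ k' l = P.pairingIn ℤ k l := by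
  obtain h | h := (hP.odd_pairingIn_iff k d).mp h
  · obtain ⟨k', hk'⟩ := exists_root_eq_sub h
    refine ⟨k', 1, le_rfl, by rw [hk', one_smul, sub_add_cancel], ?_, fun l hl => ?_⟩
    · rw [pairingIn_eq_sub_of_root_eq_sub hk', h, P.pairingIn_same]
      norm_num
    · rw [pairingIn_eq_sub_of_root_eq_sub hk', hl, sub_zero]
  · exact ⟨k, 0, zero_le_one, by simp, h, fun l _ => rfl⟩

namespace IsD4Diagram

variable {c d₁ d₂ d₃ : I} (h : IsD4Diagram P c d₁ d₂ d₃)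

include h

theorem pairingIn_eq_cartanMatrix (a b : Fin 4) :
    P.pairingIn ℤ (![d₁, c, d₂, d₃] a) (![d₁, c, d₂, d₃] b) = CartanMatrix.D 4 a b := by
  obtain ⟨h₁₂, h₁₃, h₂₃, h₁, h₂, h₃⟩ := h
  have h₂₁ := hP.pairingIn_comm d₁ d₂
  have h₃₁ := hP.pairingIn_comm d₁ d₃
  have h₃₂ := hP.pairingIn_comm d₂ d₃
  have h₁' := hP.pairingIn_comm c d₁
  have h₂' := hP.pairingIn_comm c d₂
  have h₃' := hP.pairingIn_comm c d₃
  fin_cases a <;> fin_cases b <;> simp [CartanMatrix.D] <;> omega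

theorem root_eq_or_of_pairingIn_eq_neg_one {k : I} (hk₁ : P.pairingIn ℤ k d₁ = -1)
    (hk₂ : P.pairingIn ℤ k d₂ = -1) (hk₃ : P.pairingIn ℤ k d₃ = -1) :
    P.root k = P.root c ∨ P.root k = -(P.root c + P.root d₁ + P.root d₂ + P.root d₃) := by
  obtain ⟨h₁₂, h₁₃, h₂₃, h₁, h₂, h₃⟩ := h
  obtain ⟨c₁, hc₁⟩ := exists_root_eq_add h₁
  have e₁ := P.pairingIn_eq_add_of_root_eq_add (S := ℤ) (j := d₂) hc₁
  obtain ⟨c₂, hc₂⟩ := exists_root_eq_add (P := P) (i := c₁) (j := d₂) (by omega)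
  have e₂ := P.pairingIn_eq_add_of_root_eq_add (S := ℤ) (j := d₃) hc₁
  have e₃ := P.pairingIn_eq_add_of_root_eq_add (S := ℤ) (j := d₃) hc₂
  obtain ⟨c₃, hc₃⟩ := exists_root_eq_add (P := P) (i := c₂) (j := d₃) (by omega)
  have e₄ := hP.pairingIn_add_right hc₁ k
  have e₅ := hP.pairingIn_add_right hc₂ k
  have e₆ := hP.pairingIn_add_right hc₃ k
  have e₇ := (hP.pairingIn_mem_Icc k c₃).1
  have e₈ := (hP.pairingIn_mem_Icc k c).2
  obtain h | h : P.pairingIn ℤ k c = 2 ∨ P.pairingIn ℤ k c₃ = -2 := by omega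
  · exact .inl (by rw [hP.eq_of_pairingIn_eq_two h])
  · exact .inr (by rw [hP.eq_neg_of_pairingIn_eq_neg_two h, hc₃, hc₂, hc₁])

theorem root_eq_or_of_odd {k : I} (hk₁ : Odd (P.pairingIn ℤ k d₁))
    (hk₂ : Odd (P.pairingIn ℤ k d₂)) (hk₃ : Odd (P.pairingIn ℤ k d₃)) :
    ∃ a b e : ℕ, P.root k = P.root c + a • P.root d₁ + b • P.root d₂ + e • P.root d₃ ∨
      P.root k = -(P.root c + a • P.root d₁ + b • P.root d₂ + e • P.root d₃) := by
  have h₂₁ := hP.pairingIn_comm d₂ d₁ |>.trans h.pairingIn₁₂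
  have h₃₁ := hP.pairingIn_comm d₃ d₁ |>.trans h.pairingIn₁₃
  have h₃₂ := hP.pairingIn_comm d₃ d₂ |>.trans h.pairingIn₂₃
  obtain ⟨k₁, a, ha, r₁, u₁, v₁⟩ := hP.exists_pairingIn_eq_neg_one_of_odd hk₁
  rw [← v₁ _ h.pairingIn₁₂] at hk₂
  rw [← v₁ _ h.pairingIn₁₃] at hk₃
  obtain ⟨k₂, b, hb, r₂, u₂, v₂⟩ := hP.exists_pairingIn_eq_neg_one_of_odd hk₂
  rw [← v₂ _ h.pairingIn₂₃] at hk₃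
  obtain ⟨k₃, e, he, r₃, u₃, v₃⟩ := hP.exists_pairingIn_eq_neg_one_of_odd hk₃
  rw [← v₂ _ h₂₁, ← v₃ _ h₃₁] at u₁
  rw [← v₃ _ h₃₂] at u₂
  obtain h | h := h.root_eq_or_of_pairingIn_eq_neg_one hP u₁ u₂ u₃
  · exact ⟨a, b, e, .inl (by rw [r₁, r₂, r₃, h]; abel)⟩
  · refine ⟨1 - a, 1 - b, 1 - e, .inr ?_⟩
    rw [r₁, r₂, r₃, h, sub_nsmul _ ha, sub_nsmul _ hb, sub_nsmul _ he, one_nsmul, one_nsmul,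
      one_nsmul]
    abel

theorem root_eq_neg_highest {k : I} (hk : P.pairingIn ℤ k c = -1) (hk₁ : P.pairingIn ℤ k d₁ = 0)
    (hk₂ : P.pairingIn ℤ k d₂ = 0) (hk₃ : P.pairingIn ℤ k d₃ = 0) :
    P.root k = -(2 • P.root c + P.root d₁ + P.root d₂ + P.root d₃) := by
  obtain ⟨l, hl⟩ := exists_root_eq_add hk
  have pairing_l {d} (hd : P.pairingIn ℤ c d = -1) (hkd : P.pairingIn ℤ k d = 0) :
      P.pairingIn ℤ l d = -1 := by
    rw [P.pairingIn_eq_add_of_root_eq_add hl, hd, hkd, zero_add]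
  obtain hl' | hl' := h.root_eq_or_of_pairingIn_eq_neg_one hP (pairing_l h.pairingIn₁ hk₁)
    (pairing_l h.pairingIn₂ hk₂) (pairing_l h.pairingIn₃ hk₃)
  · rw [hl, add_eq_right] at hl'
    exact absurd hl' (P.ne_zero k)
  · rw [eq_sub_of_add_eq hl.symm, hl']
    abel

variable (h₁₂ : HasSameNeighbors P d₁ d₂) (h₁₃ : HasSameNeighbors P d₁ d₃)

include h₁₂ h₁₃

theorem pairingIn_eq_zero_of_notMem {K : AddSubmonoid M}
    (hK : ∀ a, P.root (![d₁, c, d₂, d₃] a) ∈ K) {k : I} (hk : P.root k ∉ K)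
    (hk' : -P.root k ∉ K) (a : Fin 4) : P.pairingIn ℤ k (![d₁, c, d₂, d₃] a) = 0 := by
  have m₁ : P.root d₁ ∈ K := hK 0
  have mc : P.root c ∈ K := hK 1
  have m₂ : P.root d₂ ∈ K := hK 2
  have m₃ : P.root d₃ ∈ K := hK 3
  have hodd : ¬ Odd (P.pairingIn ℤ k d₁) := fun hk₁ => by
    obtain ⟨a, b, e, hr⟩ := h.root_eq_or_of_odd hP hk₁ ((h₁₂ k).mp hk₁) ((h₁₃ k).mp hk₁)
    have hmem : P.root c + a • P.root d₁ + b • P.root d₂ + e • P.root d₃ ∈ K :=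
      add_mem (add_mem (add_mem mc (nsmul_mem m₁ a)) (nsmul_mem m₂ b)) (nsmul_mem m₃ e)
    obtain hr | hr := hr
    · exact hk (hr ▸ hmem)
    · exact hk' (by rwa [hr, neg_neg])
  have eq_zero {d} (hd : P.root d ∈ K) (ho : ¬ Odd (P.pairingIn ℤ k d)) : P.pairingIn ℤ k d = 0 :=
    hP.eq_zero_of_not_odd ho (fun e => hk (e ▸ hd)) fun e => hk' (by rwa [e, neg_neg])
  have k₁ := eq_zero m₁ hodd
  have k₂ := eq_zero m₂ (by rwa [← h₁₂])
  have k₃ := eq_zero m₃ (by rwa [← h₁₃])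
  have highest_mem : 2 • P.root c + P.root d₁ + P.root d₂ + P.root d₃ ∈ K :=
    add_mem (add_mem (add_mem (nsmul_mem mc 2) m₁) m₂) m₃
  have kc : P.pairingIn ℤ k c = 0 := eq_zero mc fun ho => by
    obtain hkc | hkc := (hP.odd_pairingIn_iff k c).mp ho
    · obtain ⟨l, hl⟩ := exists_root_eq_neg P k
      have hl' := h.root_eq_neg_highest hP (k := l)
        (by rw [pairingIn_eq_neg_of_root_eq_neg hl, hkc])
        (by rw [pairingIn_eq_neg_of_root_eq_neg hl, k₁, neg_zero])
        (by rw [pairingIn_eq_neg_of_root_eq_neg hl, k₂, neg_zero])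
        (by rw [pairingIn_eq_neg_of_root_eq_neg hl, k₃, neg_zero])
      exact hk (by rwa [← neg_neg (P.root k), ← hl, hl', neg_neg])
    · exact hk' (by rwa [h.root_eq_neg_highest hP hkc k₁ k₂ k₃, neg_neg])
  fin_cases a <;> assumption

variable [P.IsIrreducible]

theorem span_root_eq_top :
    Submodule.span ℝ (P.root '' Set.range ![d₁, c, d₂, d₃]) = ⊤ := by
  refine P.span_root_image_eq_top_of_forall_orthogonal _ (Set.range_nonempty _) ?_
  rintro j hj _ ⟨a, rfl⟩
  exact hP.isOrthogonal_of_pairingIn_eq_zero (h.pairingIn_eq_zero_of_notMem hP h₁₂ h₁₃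
    (K := (Submodule.span ℝ (P.root '' Set.range ![d₁, c, d₂, d₃])).toAddSubmonoid)
    (fun a => Submodule.subset_span ⟨_, ⟨a, rfl⟩, rfl⟩) hj
    (fun hj' => hj ((Submodule.neg_mem_iff _).mp hj')) a)

theorem rootIsTypeD4 [P.IsRootSystem] [P.IsReduced] : RootIsTypeD4 P := by
  refine rootIsTypeD4_of_pairingIn_eq (h.pairingIn_eq_cartanMatrix hP) fun k => ?_
  by_contra! hk
  obtain ⟨_, ⟨a, rfl⟩, ha⟩ :=
    exists_pairing_ne_zero_of_span_root_image_eq_top P (h.span_root_eq_top hP h₁₂ h₁₃) k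
  have hka := h.pairingIn_eq_zero_of_notMem hP h₁₂ h₁₃
    (K := AddSubmonoid.closure (P.root '' Set.range ![d₁, c, d₂, d₃]))
    (fun a => AddSubmonoid.subset_closure ⟨_, ⟨a, rfl⟩, rfl⟩) hk.1 hk.2 a
  exact ha (hP.isOrthogonal_of_pairingIn_eq_zero hka).2

end IsD4Diagram

end TypeD4

section StructureConstants

variable {I : Type w₁} {M : Type w₂} {N : Type w₃} [AddCommGroup M] [Module ℝ M]
  [AddCommGroup N] [Module ℝ N]

/-- The nontrivial commutator relations of a simply laced root system with structure constants. -/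
def RootMulRel (P : RootPairing I ℝ M N) (c : I → I → ℤˣ) (i j k : I) (s : ℤˣ) : Prop :=
  P.root k = P.root i + P.root j ∧ s = c i j

/-- The trivial commutator relations of a simply laced root system. -/
def RootComRel (P : RootPairing I ℝ M N) (i j : I) : Prop :=
  P.root i + P.root j ≠ 0 ∧ P.root i + P.root j ∉ Set.range P.root

theorem units_eq_of_zsmul_eq {L : Type*} [AddCommGroup L] [IsAddTorsionFree L] {v : L} (hv : v ≠ 0)
    {s t : ℤˣ} (h : (s : ℤ) • v = (t : ℤ) • v) : s = t :=
  Units.ext (smul_left_injective ℤ hv h)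

variable {P : RootPairing I ℝ M N} [P.IsCrystallographic]

namespace IsStructureConstants

variable {c : I → I → ℤˣ} (hc : IsStructureConstants P c)

include hc

theorem swap {i j k : I} (hk : P.root k = P.root i + P.root j) : c j i = -c i j := by
  obtain ⟨L, _, _, e, h, he⟩ := hc
  have := IsAddTorsionFree.of_isTorsionFree ℂ L
  refine units_eq_of_zsmul_eq (he.linearIndependent.ne_zero k) ?_
  rw [Units.val_neg, neg_smul, ← he.lie_e_e i j k hk,
    ← he.lie_e_e j i k (by rw [hk, add_comm]), lie_skew]

theorem mul_eq_mul {i j l d m k : I} (hd : P.root d = P.root i + P.root j)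
    (hm : P.root m = P.root j + P.root l) (hk : P.root k = P.root i + P.root m)
    (h : RootComRel P i l) : c i j * c d l = c j l * c i m := by
  obtain ⟨L, _, _, e, _, he⟩ := hc
  have := IsAddTorsionFree.of_isTorsionFree ℂ L
  refine units_eq_of_zsmul_eq (he.linearIndependent.ne_zero k) ?_
  rw [Units.val_mul, Units.val_mul, mul_smul, mul_smul,
    ← he.lie_e_e d l k (by rw [hk, hd, hm, add_assoc]), ← he.lie_e_e i m k hk,
    ← zsmul_lie (e d), ← lie_zsmul (e i), ← he.lie_e_e i j d hd, ← he.lie_e_e j l m hm,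
    leibniz_lie (e i), he.lie_e_e_eq_zero i l h.1 h.2, lie_zero, add_zero]

theorem isRootTriple {i j l d m k : I} (hd : P.root d = P.root i + P.root j)
    (hm : P.root m = P.root j + P.root l) (hk : P.root k = P.root i + P.root m)
    (h : RootComRel P i l) :
    IsRootTriple (RootMulRel P c) (RootComRel P) i j l d m k (c i j) (c j l) (c i m) (c d l) where
  left := ⟨hd, rfl⟩
  right := ⟨hm, rfl⟩
  add_right := ⟨hk, rfl⟩
  left_add := ⟨by rw [hk, hd, hm, add_assoc], rfl⟩
  sign := hc.mul_eq_mul hd hm hk h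
  comRel := h

end IsStructureConstants

end StructureConstants

section SteinbergPresentation

variable {I : Type w₁} {M : Type w₂} {N : Type w₃} [AddCommGroup M] [Module ℝ M]
  [AddCommGroup N] [Module ℝ N] (P : RootPairing I ℝ M N) (c : I → I → ℤˣ)
  {C : Type u} [Category.{v} C] [CartesianMonoidalCategory C] {R : C} [NonUnitalRingObj R]

theorem steinbergRelations_iff {G : C} [GrpObj G] (x : I → (R ⟶ G)) :
    SteinbergRelations P c x ↔ RootRelations (RootMulRel P c) (RootComRel P) x where
  mp h :=
    { add := h.add
      commutator := by
        rintro i j k s ⟨hk, rfl⟩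
        exact h.commutator i j k hk
      commute := fun i j hs => h.commute i j hs.1 hs.2 }
  mpr h :=
    { add := h.add
      commutator := fun i j k hk => h.commutator i j k _ ⟨hk, rfl⟩
      commute := fun i j h₀ h₁ => h.commute i j ⟨h₀, h₁⟩ }

theorem isSteinbergGroup_iff {G : C} [GrpObj G] (x : I → (R ⟶ G)) :
    IsSteinbergGroup P c x ↔ IsRootGroup (RootMulRel P c) (RootComRel P) x where
  mp h :=
    { relations := (steinbergRelations_iff P c x).mp h.relations
      universal := fun H _ y hy => h.universal H y ((steinbergRelations_iff P c y).mpr hy) }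
  mpr h :=
    { relations := (steinbergRelations_iff P c x).mpr h.relations
      universal := fun H _ y hy => h.universal H y ((steinbergRelations_iff P c y).mp hy) }

theorem exists_isSteinbergGroup [InfinitaryPretopos C] [Finite I] (R : C) [NonUnitalRingObj R] :
    ∃ (G : C) (_ : GrpObj G) (x : I → (R ⟶ G)), IsSteinbergGroup P c x := by
  obtain ⟨G, hG, x, hx⟩ := exists_isRootGroup (RootMulRel P c) (RootComRel P) R
  exact ⟨G, hG, x, (isSteinbergGroup_iff P c x).mpr hx⟩

end SteinbergPresentation

section Decompositions

variable {I : Type w₁} {M : Type w₂} {N : Type w₃} [Finite I] [AddCommGroup M] [Module ℝ M]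
  [AddCommGroup N] [Module ℝ N] {P : RootPairing I ℝ M N} [P.IsCrystallographic]

namespace RootIsSimplyLaced

variable (hP : RootIsSimplyLaced P)

include hP

theorem rootComRel_iff {i j : I} : RootComRel P i j ↔ 0 ≤ P.pairingIn ℤ i j := by
  refine ⟨fun ⟨h₀, h⟩ => ?_, fun h => ⟨fun h₀ => ?_, fun ⟨k, hk⟩ => ?_⟩⟩
  · by_contra! hneg
    have := (hP.pairingIn_mem_Icc i j).1
    obtain h' | h' : P.pairingIn ℤ i j = -1 ∨ P.pairingIn ℤ i j = -2 := by omega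
    · obtain ⟨k, hk⟩ := exists_root_eq_add h'
      exact h ⟨k, hk⟩
    · exact h₀ (by rw [hP.eq_neg_of_pairingIn_eq_neg_two h', neg_add_cancel])
  · rw [pairingIn_eq_neg_of_root_eq_neg (eq_neg_of_add_eq_zero_left h₀), P.pairingIn_same] at h
    omega
  · rw [hP.pairingIn_eq_neg_one hk] at h
    omega

theorem pairingIn_eq_zero_of_root_eq_add {t i j k : I} (h : P.root t = P.root i + P.root j)
    (hk : P.pairingIn ℤ k t = 1) (hik : P.pairingIn ℤ i k = 1) : P.pairingIn ℤ j k = 0 := by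
  have := P.pairingIn_eq_add_of_root_eq_add (S := ℤ) (j := k) h
  have := hP.pairingIn_comm k t
  omega

theorem pairingIn_eq_zero_of_hasSameNeighbors {t j k m : I} (hjk : HasSameNeighbors P j k)
    (hk : P.pairingIn ℤ k t = 1) (hm : P.pairingIn ℤ m t = 1) (hjm : P.pairingIn ℤ j m = 0)
    (hmk : m ≠ k) : P.pairingIn ℤ m k = 0 := by
  refine hP.eq_zero_of_not_odd ?_ hmk fun h => ?_
  · rw [← hjk, hP.pairingIn_comm, hjm]
    exact Int.not_odd_zero
  · rw [pairingIn_eq_neg_of_root_eq_neg h, hk] at hm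
    omega

omit [Finite I] in
theorem exists_pairingIn_eq_one_of_odd {i j k : I} (hi : Odd (P.pairingIn ℤ k i))
    (hj : P.pairingIn ℤ k j = 0) : ∃ m, P.pairingIn ℤ m i = 1 ∧ P.pairingIn ℤ m j = 0 := by
  obtain hi | hi := (hP.odd_pairingIn_iff k i).mp hi
  · exact ⟨k, hi, hj⟩
  · obtain ⟨m, hm⟩ := exists_root_eq_neg P k
    exact ⟨m, by rw [pairingIn_eq_neg_of_root_eq_neg hm, hi, neg_neg],
      by rw [pairingIn_eq_neg_of_root_eq_neg hm, hj, neg_zero]⟩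

variable [P.IsIrreducible]

theorem rootIsTypeD4_of_hasSameNeighbors [P.IsRootSystem] [P.IsReduced] {t j k m : I}
    (hj : P.pairingIn ℤ j t = 1) (hk : P.pairingIn ℤ k t = 1) (hm : P.pairingIn ℤ m t = 1)
    (hjk₀ : P.pairingIn ℤ j k = 0) (hjm₀ : P.pairingIn ℤ j m = 0) (hkm₀ : P.pairingIn ℤ k m = 0)
    (hjk : HasSameNeighbors P j k) (hjm : HasSameNeighbors P j m) : RootIsTypeD4 P := by
  obtain ⟨c, hc⟩ := exists_root_eq_neg P t
  have pairing_c {d} (hd : P.pairingIn ℤ d t = 1) : P.pairingIn ℤ c d = -1 := by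
    rw [pairingIn_eq_neg_of_root_eq_neg hc, hP.pairingIn_comm, hd]
  exact IsD4Diagram.rootIsTypeD4 hP
    ⟨hjk₀, hjm₀, hkm₀, pairing_c hj, pairing_c hk, pairing_c hm⟩ hjk hjm

variable (hM : 4 ≤ Module.finrank ℝ M)

include hM

theorem exists_root_eq_add (t : I) : ∃ i j, P.root t = P.root i + P.root j := by
  obtain ⟨i, j, h, -⟩ := hP.exists_root_eq_add_notMem_span hM t 0 0
  exact ⟨i, j, h⟩

theorem exists_root_eq_add_of_ne {i t : I} (hi : P.pairingIn ℤ i t = 1) (z : I) :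
    ∃ k l, P.root t = P.root k + P.root l ∧ P.pairingIn ℤ i k = 1 ∧ k ≠ z := by
  obtain ⟨k, l, h, hk, hl⟩ := hP.exists_root_eq_add_notMem_span hM t (P.root i) (P.root z)
  have ne_of_notMem {k} (hk : P.root k ∉ Submodule.span ℝ {P.root t, P.root i, P.root z}) :
      i ≠ k ∧ k ≠ z :=
    ⟨fun h => hk (h ▸ Submodule.subset_span (by simp)),
      fun h => hk (h ▸ Submodule.subset_span (by simp))⟩
  have h₁ := hP.pairingIn_le_one (ne_of_notMem hk).1
  have h₂ := hP.pairingIn_le_one (ne_of_notMem hl).1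
  have h₃ := hP.pairingIn_add_right h i
  obtain h' | h' : P.pairingIn ℤ i k = 1 ∨ P.pairingIn ℤ i l = 1 := by omega
  · exact ⟨k, l, h, h', (ne_of_notMem hk).2⟩
  · exact ⟨l, k, h.trans (add_comm _ _), h', (ne_of_notMem hl).2⟩

theorem exists_not_hasSameNeighbors [P.IsRootSystem] [P.IsReduced] (hD : ¬ RootIsTypeD4 P)
    {t i j : I} (h : P.root t = P.root i + P.root j) :
    ∃ k l, P.root t = P.root k + P.root l ∧ P.pairingIn ℤ i k = 1 ∧ ¬ HasSameNeighbors P j k := by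
  by_contra! hall
  have hi := hP.pairingIn_eq_one_left h
  obtain ⟨k, l, hkl, hik, -⟩ := hP.exists_root_eq_add_of_ne hM hi i
  obtain ⟨m, n, hmn, him, hmk⟩ := hP.exists_root_eq_add_of_ne hM hi k
  have hkt := hP.pairingIn_eq_one_left hkl
  have hmt := hP.pairingIn_eq_one_left hmn
  have hjk := hP.pairingIn_eq_zero_of_root_eq_add h hkt hik
  have hjm := hP.pairingIn_eq_zero_of_root_eq_add h hmt him
  have hmk := hP.pairingIn_eq_zero_of_hasSameNeighbors (hall k l hkl hik) hkt hmt hjm hmk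
  exact hD (hP.rootIsTypeD4_of_hasSameNeighbors (hP.pairingIn_eq_one_right h) hkt hmt hjk hjm
    ((hP.pairingIn_comm k m).trans hmk) (hall k l hkl hik) (hall m n hmn him))

theorem exists_pairingIn_eq_one_of_hasSameNeighbors {i j : I} (h : P.pairingIn ℤ i j = 0)
    (hij : HasSameNeighbors P i j) : ∃ m, P.pairingIn ℤ m i = 1 ∧ P.pairingIn ℤ m j = 1 := by
  obtain ⟨k, l, hkl⟩ := hP.exists_root_eq_add hM i
  have hk := hP.pairingIn_eq_one_left hkl
  have hl := hP.pairingIn_eq_one_right hkl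
  have hsum := P.pairingIn_eq_add_of_root_eq_add (S := ℤ) (j := j) hkl
  obtain hkj | hkj := (hP.odd_pairingIn_iff k j).mp ((hij k).mp (hk ▸ odd_one))
  · exact ⟨k, hk, hkj⟩
  · exact ⟨l, hl, by omega⟩

end RootIsSimplyLaced

end Decompositions

section SteinbergExtensions

variable {I : Type w₁} {M : Type w₂} {N : Type w₃} [Finite I] [AddCommGroup M] [Module ℝ M]
  [AddCommGroup N] [Module ℝ N] {P : RootPairing I ℝ M N} [P.IsCrystallographic]
  (hP : RootIsSimplyLaced P) {c : I → I → ℤˣ}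
  {C : Type u} [Category.{v} C] [CartesianMonoidalCategory C] [InfinitaryPretopos C]
  {R : C} [NonUnitalRingObj R] {E : Subobject R} (hE : IsWeakUnit E)
  {X G : C} [GrpObj X] [GrpObj G] {x : I → (R ⟶ G)}
  (hx : RootRelations (RootMulRel P c) (RootComRel P) x) {f : X ⟶ G} (hf : IsCentralExtension f)

namespace RootIsSimplyLaced

include hP hE hx hf

theorem liftsCommute_of_root_eq_add {i j k l : I} (h : P.root i = P.root k + P.root l)
    (hk : 0 ≤ P.pairingIn ℤ k j) (hl : 0 ≤ P.pairingIn ℤ l j) : LiftsCommute f (x i) (x j) :=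
  liftsCommute_of_mulRel hx hE hf ⟨h, rfl⟩ (hP.rootComRel_iff.mpr hk) (hP.rootComRel_iff.mpr hl)

theorem liftsCommute_of_odd {i j k : I} (h : P.pairingIn ℤ i j = 0)
    (hi : Odd (P.pairingIn ℤ k i)) (hj : ¬ Odd (P.pairingIn ℤ k j)) :
    LiftsCommute f (x i) (x j) := by
  have hji : P.pairingIn ℤ j i = 0 := (hP.pairingIn_comm j i).trans h
  have hkj : P.pairingIn ℤ k j = 0 := by
    refine hP.eq_zero_of_not_odd hj (fun e => ?_) fun e => ?_
    · exact Int.not_odd_zero (by rwa [e, hji] at hi)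
    · exact Int.not_odd_zero (by rwa [pairingIn_eq_neg_of_root_eq_neg e, hji, neg_zero] at hi)
  obtain ⟨m, hm, hmj⟩ := hP.exists_pairingIn_eq_one_of_odd hi hkj
  obtain ⟨l, hl⟩ := hP.exists_root_eq_add_of_pairingIn_eq_one hm
  refine hP.liftsCommute_of_root_eq_add hE hx hf hl hmj.ge ?_
  have := P.pairingIn_eq_add_of_root_eq_add (S := ℤ) (j := j) hl
  omega

theorem liftsCommute_of_not_hasSameNeighbors {i j : I} (h : P.pairingIn ℤ i j = 0)
    (hij : ¬ HasSameNeighbors P i j) : LiftsCommute f (x i) (x j) := by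
  obtain ⟨k, hk⟩ := not_forall.mp hij
  by_cases hi : Odd (P.pairingIn ℤ k i)
  · exact hP.liftsCommute_of_odd hE hx hf h hi (by tauto)
  · exact (hP.liftsCommute_of_odd hE hx hf ((hP.pairingIn_comm j i).trans h) (by tauto) hi).symm

variable [P.IsIrreducible] (hM : 4 ≤ Module.finrank ℝ M)

include hM

theorem liftsCommute_of_pairingIn_pos {i j : I} (h : 0 < P.pairingIn ℤ i j) :
    LiftsCommute f (x i) (x j) := by
  obtain ⟨k, l, hkl, hk, hl⟩ := hP.exists_root_eq_add_notMem_span hM i (P.root j) 0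
  have pairing_le {k} (hk : P.root k ∉ Submodule.span ℝ {P.root i, P.root j, 0}) :
      P.pairingIn ℤ k j ≤ 1 :=
    hP.pairingIn_le_one fun h => hk (h ▸ Submodule.subset_span (by simp))
  have := pairing_le hk
  have := pairing_le hl
  have := P.pairingIn_eq_add_of_root_eq_add (S := ℤ) (j := j) hkl
  exact hP.liftsCommute_of_root_eq_add hE hx hf hkl (by omega) (by omega)

theorem liftsCommute_self (i : I) : LiftsCommute f (x i) (x i) :=
  hP.liftsCommute_of_pairingIn_pos hE hx hf hM (by rw [P.pairingIn_same]; norm_num)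

theorem liftsCommute_of_pairingIn_eq_one {i t : I} (h : P.pairingIn ℤ i t = 1) :
    LiftsCommute f (x t) (x i) :=
  (hP.liftsCommute_of_pairingIn_pos hE hx hf hM (by omega)).symm

variable (hc : IsStructureConstants P c)

include hc

theorem rootBracket_mul_eq {t i j k l : I} (h : P.root t = P.root i + P.root j)
    (h' : P.root t = P.root k + P.root l) (hik : P.pairingIn ℤ i k = 1)
    (hjk : ¬ HasSameNeighbors P j k) {T : C} (p q r : T ⟶ R) :
    rootBracket hf x i j (c i j) p (q * r) = rootBracket hf x k l (c k l) (p * q) r := by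
  obtain ⟨m, hm⟩ := hP.exists_root_eq_add_of_pairingIn_eq_one hik
  have hj : P.root j = P.root m + P.root l := by
    rw [← add_right_inj (P.root i), ← h, h', hm, add_assoc]
  have hi := hP.pairingIn_eq_one_left h
  have hk := hP.pairingIn_eq_one_left h'
  have hil : RootComRel P i l := by
    have := hP.pairingIn_add_right h' i
    exact hP.rootComRel_iff.mpr (by omega)
  have hjk₀ := hP.pairingIn_eq_zero_of_root_eq_add h hk hik
  exact _root_.rootBracket_mul_eq hx hf (hc.isRootTriple hm hj h hil)
    (hP.liftsCommute_self hE hx hf hM t)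
    (hP.liftsCommute_of_pairingIn_eq_one hE hx hf hM (hP.pairingIn_eq_one_right h))
    (hP.liftsCommute_of_pairingIn_eq_one hE hx hf hM hk)
    (hP.liftsCommute_of_not_hasSameNeighbors hE hx hf hjk₀ hjk).symm p q r

variable [P.IsRootSystem] [P.IsReduced] (hD : ¬ RootIsTypeD4 P)
  (hcomm : ∀ (T : C) (p q : T ⟶ R), p * q = q * p)

include hD hcomm

theorem exists_isRootLift {t i j : I} (h : P.root t = P.root i + P.root j) :
    ∃ y : R ⟶ X, IsRootLift hf x i j (c i j) y := by
  obtain ⟨k, l, hkl, hik, hjk⟩ := hP.exists_not_hasSameNeighbors hM hD h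
  exact _root_.exists_isRootLift hE hf hx ⟨h, rfl⟩
    (hP.liftsCommute_of_pairingIn_eq_one hE hx hf hM (hP.pairingIn_eq_one_left h))
    (hP.liftsCommute_self hE hx hf hM t) (rootBracket_balanced_of_comm hf hE hcomm
      fun p q r => hP.rootBracket_mul_eq hE hx hf hM hc h hkl hik hjk p q r)

theorem rootBracket_comm {t i j : I} (h : P.root t = P.root i + P.root j) {T : C}
    (p q : T ⟶ R) : rootBracket hf x j i (c j i) p q = rootBracket hf x i j (c i j) p q := by
  obtain ⟨y, hy⟩ := hP.exists_isRootLift hE hx hf hM hc hD hcomm h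
  rw [hc.swap h, rootBracket_swap, hy, hy, hcomm]

theorem rootBracket_eq_of_pairingIn_eq_one {t i j k l : I} (h : P.root t = P.root i + P.root j)
    (h' : P.root t = P.root k + P.root l) (hik : P.pairingIn ℤ i k = 1) {T : C} (p q : T ⟶ R) :
    rootBracket hf x i j (c i j) p q = rootBracket hf x k l (c k l) p q := by
  have eq_of_not_hasSameNeighbors {i j k l : I} (h : P.root t = P.root i + P.root j)
      (h' : P.root t = P.root k + P.root l) (hik : P.pairingIn ℤ i k = 1)
      (hjk : ¬ HasSameNeighbors P j k) :
      rootBracket hf x i j (c i j) p q = rootBracket hf x k l (c k l) p q :=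
    rootBracket_eq_of_comm hf hE hcomm
      (fun p q r => hP.rootBracket_mul_eq hE hx hf hM hc h h' hik hjk p q r) p q
  by_cases hjk : HasSameNeighbors P j k
  · obtain ⟨m, n, hmn, him, hjm⟩ := hP.exists_not_hasSameNeighbors hM hD h
    have hkm : ¬ HasSameNeighbors P k m := fun hkm => hjm fun a => (hjk a).trans (hkm a)
    have hm := hP.pairingIn_eq_one_left hmn
    have hlm : P.pairingIn ℤ l m = 1 := by
      have hjm₀ := hP.pairingIn_eq_zero_of_root_eq_add h hm him
      have hmk₀ := hP.pairingIn_eq_zero_of_hasSameNeighbors hjk (hP.pairingIn_eq_one_left h') hm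
        hjm₀ fun e => hjm (e ▸ hjk)
      rw [hP.pairingIn_comm, ← hm, hP.pairingIn_add_right h', hmk₀, zero_add]
    rw [eq_of_not_hasSameNeighbors h hmn him hjm,
      ← eq_of_not_hasSameNeighbors (h'.trans (add_comm _ _)) hmn hlm hkm,
      hP.rootBracket_comm hE hx hf hM hc hD hcomm h']
  · exact eq_of_not_hasSameNeighbors h h' hik hjk

theorem rootBracket_eq {t i j k l : I} (h : P.root t = P.root i + P.root j)
    (h' : P.root t = P.root k + P.root l) {T : C} (p q : T ⟶ R) :
    rootBracket hf x i j (c i j) p q = rootBracket hf x k l (c k l) p q := by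
  have eq_of_pairingIn_pos {k l : I} (h' : P.root t = P.root k + P.root l)
      (hik : 0 < P.pairingIn ℤ i k) :
      rootBracket hf x i j (c i j) p q = rootBracket hf x k l (c k l) p q := by
    obtain rfl | hne := eq_or_ne i k
    · rw [P.root.injective (add_left_cancel (h.symm.trans h'))]
    · have := hP.pairingIn_le_one hne
      exact hP.rootBracket_eq_of_pairingIn_eq_one hE hx hf hM hc hD hcomm h h' (by omega) p q
  have hsum := (hP.pairingIn_add_right h' i).symm.trans (hP.pairingIn_eq_one_left h)
  obtain hik | hil : 0 < P.pairingIn ℤ i k ∨ 0 < P.pairingIn ℤ i l := by omega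
  · exact eq_of_pairingIn_pos h' hik
  · rw [eq_of_pairingIn_pos (h'.trans (add_comm _ _)) hil,
      hP.rootBracket_comm hE hx hf hM hc hD hcomm h']

theorem exists_forall_isRootLift (t : I) :
    ∃ y : R ⟶ X, ∀ i j s, RootMulRel P c i j t s → IsRootLift hf x i j s y := by
  obtain ⟨k, l, hkl⟩ := hP.exists_root_eq_add hM t
  obtain ⟨y, hy⟩ := hP.exists_isRootLift hE hx hf hM hc hD hcomm hkl
  refine ⟨y, ?_⟩
  rintro i j s ⟨h, rfl⟩ T p q
  rw [← hy, hP.rootBracket_eq hE hx hf hM hc hD hcomm h hkl]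

theorem liftsCommute_of_hasSameNeighbors {i j : I} (h : P.pairingIn ℤ i j = 0)
    (hij : HasSameNeighbors P i j) : LiftsCommute f (x i) (x j) := by
  obtain ⟨m, hmi, hmj⟩ := hP.exists_pairingIn_eq_one_of_hasSameNeighbors hM h hij
  obtain ⟨k, hi⟩ := hP.exists_root_eq_add_of_pairingIn_eq_one hmi
  obtain ⟨l, hj⟩ := hP.exists_root_eq_add_of_pairingIn_eq_one hmj
  rw [add_comm] at hi
  have hkj : P.pairingIn ℤ k j = -1 := by
    have := P.pairingIn_eq_add_of_root_eq_add (S := ℤ) (j := j) hi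
    omega
  have hkl : RootComRel P k l := by
    have := hP.pairingIn_add_right hj k
    have := hP.pairingIn_eq_neg_one hi
    exact hP.rootComRel_iff.mpr (by omega)
  obtain ⟨t, ht⟩ := _root_.exists_root_eq_add hkj
  have ht' : P.root t = P.root i + P.root l := by rw [ht, hi, hj, add_assoc]
  obtain ⟨y, hy⟩ := hP.exists_forall_isRootLift hE hx hf hM hc hD hcomm t
  refine liftsCommute_of_rootBracket_mul_eq hx hf (hc.isRootTriple hi hj ht hkl)
    (hP.liftsCommute_self hE hx hf hM t)
    (hP.liftsCommute_of_pairingIn_eq_one hE hx hf hM (hP.pairingIn_eq_one_right ht))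
    (hP.liftsCommute_of_pairingIn_eq_one hE hx hf hM (hP.pairingIn_eq_one_left ht')) hE
    fun p q r => ?_
  rw [hy k j _ ⟨ht, rfl⟩, hy i l _ ⟨ht', rfl⟩, mul_assoc]

theorem liftsCommute {i j : I} (h : RootComRel P i j) : LiftsCommute f (x i) (x j) := by
  obtain h | h := (hP.rootComRel_iff.mp h).eq_or_lt
  · by_cases hij : HasSameNeighbors P i j
    · exact hP.liftsCommute_of_hasSameNeighbors hE hx hf hM hc hD hcomm h.symm hij
    · exact hP.liftsCommute_of_not_hasSameNeighbors hE hx hf h.symm hij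
  · exact hP.liftsCommute_of_pairingIn_pos hE hx hf hM h

end RootIsSimplyLaced

end SteinbergExtensions

theorem centrallyClosed_of_isSteinbergGroup {I : Type w₁} {M : Type w₂} {N : Type w₃} [Finite I]
    [AddCommGroup M] [Module ℝ M] [AddCommGroup N] [Module ℝ N] {P : RootPairing I ℝ M N}
    [P.IsCrystallographic] [P.IsReduced] [P.IsRootSystem] [P.IsIrreducible]
    (hP : RootIsSimplyLaced P) (hM : 4 ≤ Module.finrank ℝ M) (hD : ¬ RootIsTypeD4 P)
    {c : I → I → ℤˣ} (hc : IsStructureConstants P c)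
    {C : Type u} [Category.{v} C] [CartesianMonoidalCategory C] [InfinitaryPretopos C]
    {R : C} [NonUnitalRingObj R] (hR : WeaklyUnital R)
    (hcomm : ∀ (T : C) (p q : T ⟶ R), p * q = q * p) {G : C} [GrpObj G] {x : I → (R ⟶ G)}
    (hx : IsSteinbergGroup P c x) : CentrallyClosed G := by
  obtain ⟨E, hE⟩ := hR
  intro X _ f hf
  have hx := (isSteinbergGroup_iff P c x).mp hx
  refine hx.exists_section hE hf (fun t => ?_) (hP.liftsCommute_self hE hx.relations hf hM)
    (fun i j => hP.liftsCommute hE hx.relations hf hM hc hD hcomm)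
    (hP.exists_forall_isRootLift hE hx.relations hf hM hc hD hcomm)
  obtain ⟨i, j, h⟩ := hP.exists_root_eq_add hM t
  exact ⟨i, j, c i j, ⟨h, rfl⟩, hP.liftsCommute_of_pairingIn_eq_one hE hx.relations hf hM
    (hP.pairingIn_eq_one_left h)⟩

theorem mainTheorem7 {C : Type u} [Category.{v} C] [CartesianMonoidalCategory C]
    [InfinitaryPretopos C] (R : C) [NonUnitalRingObj R] (hR : WeaklyUnital R) :
    (∀ ℓ : ℕ, 4 ≤ ℓ →
      (∃ (G : C) (_ : GrpObj G) (x : ∀ i j : Fin (ℓ + 1), i ≠ j → (R ⟶ G)),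
        IsLinearSteinbergGroup x) ∧
      ∀ (G : C) [GrpObj G] (x : ∀ i j : Fin (ℓ + 1), i ≠ j → (R ⟶ G)),
        IsLinearSteinbergGroup x → CentrallyClosed G) ∧
    ((∀ (T : C) (p q : T ⟶ R), p * q = q * p) →
      ∀ (I : Type w₁) (M : Type w₂) (N : Type w₃) [Finite I]
        [AddCommGroup M] [Module ℝ M] [AddCommGroup N] [Module ℝ N]
        (P : RootPairing I ℝ M N) [P.IsRootSystem] [P.IsCrystallographic] [P.IsReduced]
        [P.IsIrreducible],
        RootIsSimplyLaced P → 4 ≤ Module.finrank ℝ M → ¬ RootIsTypeD4 P →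
        ∀ c : I → I → ℤˣ, IsStructureConstants P c →
          (∃ (G : C) (_ : GrpObj G) (x : I → (R ⟶ G)), IsSteinbergGroup P c x) ∧
          ∀ (G : C) [GrpObj G] (x : I → (R ⟶ G)),
            IsSteinbergGroup P c x → CentrallyClosed G) := by
  refine ⟨fun ℓ hℓ => ⟨exists_isLinearSteinbergGroup (ℓ + 1) R, fun G _ x hx =>
    centrallyClosed_of_isLinearSteinbergGroup hR (by omega) hx⟩, ?_⟩
  intro hcomm I M N _ _ _ _ _ P _ _ _ _ hP hM hD c hc
  exact ⟨exists_isSteinbergGroup P c R, fun G _ x hx =>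
    centrallyClosed_of_isSteinbergGroup hP hM hD hc hR hcomm hx⟩
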